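/- **Theorem.** There is an absolute constant $C$ such that for every integer $n\ge 1$ there is an abstract tile assembly (aTAM) system $\Gamma=(T,\sigma,2)$ at temperature $2$, whose seed $\sigma$ is a single tile of a type in $T$, with the following properties. 1. $|T|\le C(1+\log n)$, i.e. $\Gamma$ has $O(\log n)$ tile types. 2. $\Gamma$ is $2$-extensible: to every producible assembly, tiles can stably attach at no more than $2$ different locations. 3. $\Gamma$ is a fair robust random $n$ generator: $\Gamma$ is finite (every producible assembly can grow into a terminal one), and its set of terminal assemblies can be partitioned into $n$ sets $X_1,\dots,X_n$, independent of the concentrations, such that for every concentration distribution $P$ on $T$ and all $i,j$ $$\sum_{\alpha\in X_i}\Pr\nolimits_P[\Gamma\to\alpha]=\sum_{\alpha\in X_j}\Pr\nolimits_P[\Gamma\to\alpha].$$ Moreover $\sum_{\alpha\ \mathrm{terminal}}\Pr_P[\Gamma\to\alpha]=1$, so each of these sums is $1/n$. 4. For every concentration distribution $P$ the expected space satisfies $\sum_{\alpha\ \mathrm{terminal}}|\alpha|\cdot\Pr_P[\Gamma\to\alpha]\le C(1+\log n)$, where $|\alpha|$ is the number of tiles of $\alpha$. Here a tile is a unit square,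 possibly with a label, with a glue on each edge, and each glue has a non-negative integer strength. Tiles may be translated but not rotated, and an assembly is a finite set of tiles at distinct positions of $\mathbb Z^2$. Two adjacent tiles are bonded with the strength of the glue on their abutting edges if these glues agree, and with strength $0$ otherwise. An assembly is stable if every cut of its bond graph has weight at least the temperature $2$. The producible assemblies are obtained from $\sigma$ by successively attaching single tiles of types in $T$ such that each resulting assembly is stable; a terminal assembly is a producible one to which nothing can attach. A concentration distribution is a function $P:T\to(0,1]$ with $\sum_{t\in T}P(t)=1$. The assembly process is the Markov chain started at $\sigma$ in which each possible attachment to the current assembly is chosen with probability proportional to the concentration of its tile type, and $\Pr_P[\Gamma\to\alpha]$ is the probability that it ends in $\alpha$. -/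

import Mathlib

open scoped NNReal ENNReal

namespace ATAM

/-- A tile (type): a unit square whose four edges carry glues from the alphabet `G`, together with
a finite string label (the empty string for an unlabelled tile). Tiles are never rotated. -/
structure Tile (G : Type) where
  north : G
  east : G
  south : G
  west : G
  label : String

/-- A translated copy of a tile, centred at a point of the integer lattice. -/
structure PlacedTile (G : Type) where
  tile : Tile G
  pos : ℤ × ℤ

/-- An assembly: a finite set of tiles at pairwise distinct positions. -/
@[ext] structure Assembly (G : Type) where
  tiles : Finset (PlacedTile G)
  pos_unique : ∀ a ∈ tiles, ∀ b ∈ tiles, a.pos = b.pos → a = b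

variable {G : Type}

open Classical in
/-- The weight of the edge between `a` and `b` in the bond graph: the strength of the glue shared by
the two abutting edges, and `0` if `a` and `b` are not adjacent or these two glues differ. -/
noncomputable def bond (str : G → ℕ) (a b : PlacedTile G) : ℕ :=
  if b.pos = a.pos + (1, 0) ∧ a.tile.east = b.tile.west then str a.tile.east
  else if b.pos = a.pos + (-1, 0) ∧ a.tile.west = b.tile.east then str a.tile.west
  else if b.pos = a.pos + (0, 1) ∧ a.tile.north = b.tile.south then str a.tile.north
  else if b.pos = a.pos + (0, -1) ∧ a.tile.south = b.tile.north then str a.tile.south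
  else 0

namespace Assembly

/-- The space of an assembly: its number of tiles. -/
def space (α : Assembly G) : ℕ := α.tiles.card

open Classical in
/-- `τ`-stability: every cut of the bond graph has weight at least `τ`. -/
def Stable (str : G → ℕ) (τ : ℕ) (α : Assembly G) : Prop :=
  ∀ S ⊆ α.tiles, S.Nonempty → S ≠ α.tiles →
    τ ≤ ∑ a ∈ S, ∑ b ∈ α.tiles \ S, bond str a b

end Assembly

/-- A tile system `Γ = (T, σ, τ)` over a glue alphabet `G` with glue strengths `strength`. The seed
consists of tiles of the types in `T`. -/
structure TileSystem (G : Type) where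
  strength : G → ℕ
  tileSet : Finset (Tile G)
  seed : Assembly G
  seed_mem : ∀ a ∈ seed.tiles, a.tile ∈ tileSet
  temperature : ℕ
  temperature_pos : 0 < temperature

/-- A concentration distribution over a tile set `T`; its values off `T` are never used. -/
structure Concentration (T : Finset (Tile G)) where
  conc : Tile G → ℝ≥0
  conc_pos : ∀ t ∈ T, 0 < conc t
  conc_sum : ∑ t ∈ T, conc t = 1

namespace TileSystem

variable (Γ : TileSystem G)

open Classical in
/-- `B` arises from `A` by the stable attachment of the single tile `b`, of a type in `T`. (Since `B`
is an assembly and `b` is not in `A`, the position of `b` is empty in `A`.) -/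
def Attaches (A : Assembly G) (b : PlacedTile G) (B : Assembly G) : Prop :=
  b.tile ∈ Γ.tileSet ∧ b ∉ A.tiles ∧ B.tiles = insert b A.tiles ∧
    B.Stable Γ.strength Γ.temperature

/-- `A →₁ B`: growth by one single-tile attachment. -/
def Step (A B : Assembly G) : Prop := ∃ b, Γ.Attaches A b B

/-- `A → B`: growth by zero or more single-tile attachments. -/
def Grows (A B : Assembly G) : Prop := Relation.ReflTransGen Γ.Step A B

/-- The set of producible assemblies. -/
def producible : Set (Assembly G) := {α | Γ.Grows Γ.seed α}

/-- The frontier of an assembly: the placed tiles that can stably attach to it. -/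
def frontier (A : Assembly G) : Set (PlacedTile G) := {b | ∃ B, Γ.Attaches A b B}

/-- The set of terminal assemblies: producible, and nothing can attach. -/
def terminal : Set (Assembly G) := {α | α ∈ Γ.producible ∧ Γ.frontier α = ∅}

/-- A tile system is finite if every producible assembly can grow into a terminal one. -/
def IsFinite : Prop := ∀ β ∈ Γ.producible, ∃ α ∈ Γ.terminal, Γ.Grows β α

/-- `k`-extensibility: at most `k` locations of any producible assembly admit an attachment. -/
def Extensible (k : ℕ) : Prop :=
  ∀ α ∈ Γ.producible, (PlacedTile.pos '' Γ.frontier α).encard ≤ k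

variable {Γ}

/-- The transition probability from `A` to `B`: the concentration of the tile whose attachment
turns `A` into `B` (there is at most one), divided by the total concentration of all possible
attachments to `A`. It is `0` if `A →₁ B` fails; in particular nothing leaves a terminal assembly. -/
noncomputable def trans (P : Concentration Γ.tileSet) (A B : Assembly G) : ℝ≥0∞ :=
  (∑' b : {b | Γ.Attaches A b B}, (P.conc b.1.tile : ℝ≥0∞)) /
    ∑' b : Γ.frontier A, (P.conc b.1.tile : ℝ≥0∞)

open Classical in
/-- `law P k A` is the probability that the assembly process, started in the seed, makes at least
`k` transitions and is in the state `A` after the `k`-th one. -/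
noncomputable def law (P : Concentration Γ.tileSet) : ℕ → Assembly G → ℝ≥0∞
  | 0, A => if A = Γ.seed then 1 else 0
  | k + 1, B => ∑' A, law P k A * trans P A B

/-- The probability that the process ends in the terminal assembly `A`. Every transition adds a
tile, so the events that `A` is the state after the `k`-th transition are pairwise disjoint. -/
noncomputable def probTerm (P : Concentration Γ.tileSet) (A : Assembly G) : ℝ≥0∞ :=
  ∑' k, law P k A

/-- The probability that the process ends in one of the terminal assemblies of `X`. -/
noncomputable def probOf (P : Concentration Γ.tileSet) (X : Set (Assembly G)) : ℝ≥0∞ :=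
  ∑' A : X, probTerm P A.1

/-- The expected space of the system relative to the concentration distribution `P`. -/
noncomputable def expectedSpace (P : Concentration Γ.tileSet) : ℝ≥0∞ :=
  ∑' A : Γ.terminal, (A.1.space : ℝ≥0∞) * probTerm P A.1

variable (Γ)

/-- A robust random `n` generator with bias `b`: a finite system whose terminal assemblies can be
partitioned into `n` sets, the same for all concentration distributions, whose probabilities differ
by at most `b` (as `i` and `j` may be exchanged, the inequality bounds the absolute difference). -/
def IsRobustRandomGenerator (n : ℕ) (b : ℝ≥0) : Prop :=
  Γ.IsFinite ∧ ∃ X : Fin n → Set (Assembly G),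
    (∀ i, (X i).Nonempty) ∧ Pairwise (Function.onFun Disjoint X) ∧ ⋃ i, X i = Γ.terminal ∧
    ∀ P : Concentration Γ.tileSet, ∀ i j, probOf P (X i) ≤ probOf P (X j) + b

/-- A fair robust random `n` generator: bias `0`. -/
def IsFairRobustRandomGenerator (n : ℕ) : Prop := Γ.IsRobustRandomGenerator n 0

end TileSystem

end ATAM

set_option linter.unusedSectionVars false


/-! The assembly is a row of gadgets of width 11. Each gadget produces one biased random outcome and
hands the state of a finite automaton to the next gadget. Once its frame has grown, a left and a
right arm race for a common cell, and each needs seven attachments, counting the one that claims the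
cell. The race tiles carry no state, so all gadgets use the same types, and for given concentrations
the left arm always wins with the same probability α and the right arm with β = 1 - α. All five race
types occur in both arms, so the rarest one delays both sides; hence α and β are at least 2^-12
whatever the concentrations (`exists_race_probabilities`). The report of the outcome waits until the
loser has completed its arm, so that at most two locations are ever open. The exit tile then joins
outcome and state by two glues of strength 1.

Von Neumann's trick turns outcomes into fair bits: the pairs (true, false) and (false, true) both
have probability αβ, and equal pairs are discarded. If `k` is the binary length of `n`, then `k`
bits form a number that is redrawn unless it is below `n`. The automaton only remembers how many
bits were drawn, how they compare with the leading bits of `n`, and a pending outcome. These are 9k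
running states, whence O(log n) tile types. The number itself is not in the state, but the outcomes
stay legible in the assembly, and this defines the parts of the partition. No tiles continue a
halted state, so growth stops there.

The proof has two halves. Combinatorially, `Machine.represents` identifies the assembly process with
an explicit chain whose states are the outcomes of the complete gadgets and the progress in the
current one. This rests on finite checks for a single gadget (`check_progressStates`,
`exposuresOk_fullItems`) and on the inertness of complete gadgets (`oldTiles_inert`). Analytically,
a superharmonic function bounds a total expected reward (`Represents.tsum_expect_le`). The function
is assembled from `Machine.potential`, `drawVal` and `bitVal`. With cost 1 per tile it yields
expected space O(k) and almost sure termination. With cost 0 it yields probability at most 1/n for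
each value, and since the total is 1, equality holds. -/

namespace ATAM

/-! ### Stability under the attachment of one tile. -/

section Stability

variable {G : Type}

theorem bond_comm (str : G → ℕ) (a b : PlacedTile G) : bond str a b = bond str b a := by
  rcases a with ⟨⟨an, ae, as, aw, al⟩, ax, ay⟩
  rcases b with ⟨⟨bn, be, bs, bw, bl⟩, bx, bY⟩
  simp only [bond, Prod.mk_add_mk, Prod.mk.injEq]
  split_ifs <;> grind

open Classical in
theorem insert_sdiff_self {E : Type} {A : Finset E} {b : E} (hb : b ∉ A) :
    insert b A \ {b} = A := by
  ext x
  simp only [Finset.mem_sdiff, Finset.mem_insert, Finset.mem_singleton]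
  exact ⟨fun h => h.1.resolve_left h.2, fun h => ⟨Or.inr h, fun e => hb (e ▸ h)⟩⟩

open Classical in
theorem Assembly.Stable.bond_le {str : G → ℕ} {τ : ℕ} {A B : Assembly G} {b : PlacedTile G}
    (hB : B.Stable str τ) (hb : b ∉ A.tiles) (hAB : B.tiles = insert b A.tiles)
    (hA : A.tiles.Nonempty) : τ ≤ ∑ a ∈ A.tiles, bond str a b := by
  have h := hB {b} (by simp [hAB]) (by simp) (by
    obtain ⟨a, ha⟩ := hA
    intro h
    have : a ∈ ({b} : Finset (PlacedTile G)) := by rw [h, hAB]; simp [ha]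
    rw [Finset.mem_singleton] at this
    exact hb (this ▸ ha))
  rw [Finset.sum_singleton, hAB, insert_sdiff_self hb] at h
  simpa only [bond_comm str b] using h

open Classical in
-- A cut of the larger assembly restricts to a cut of `A`, except for the cut that isolates the new
-- tile; only that one needs the bond sum.
theorem Assembly.Stable.of_bond {str : G → ℕ} {τ : ℕ} {A B : Assembly G} {b : PlacedTile G}
    (hA : A.Stable str τ) (hb : b ∉ A.tiles) (hAB : B.tiles = insert b A.tiles)
    (h : τ ≤ ∑ a ∈ A.tiles, bond str a b) : B.Stable str τ := by
  intro S hS hne hS'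
  have key : ∀ S' : Finset (PlacedTile G), S' ⊆ A.tiles → S' ⊆ S → Disjoint (A.tiles \ S') S →
      S'.Nonempty → S' ≠ A.tiles → τ ≤ ∑ a ∈ S, ∑ b ∈ B.tiles \ S, bond str a b := by
    intro S' h1 h2 h3 h4 h5
    refine (hA S' h1 h4 h5).trans ?_
    refine (Finset.sum_le_sum_of_subset h2).trans ?_
    refine Finset.sum_le_sum fun a _ => Finset.sum_le_sum_of_subset fun x hx => ?_
    have hx' := Finset.disjoint_left.1 h3 hx
    simp only [Finset.mem_sdiff] at hx ⊢
    exact ⟨by rw [hAB]; exact Finset.mem_insert_of_mem hx.1, hx'⟩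
  by_cases hbS : b ∈ S
  · by_cases hc : S.erase b = ∅
    · have : S = {b} := by
        rw [Finset.erase_eq_empty_iff] at hc
        exact hc.resolve_left hne.ne_empty
      subst this
      rw [Finset.sum_singleton, hAB, insert_sdiff_self hb]
      simpa only [bond_comm str b] using h
    · refine key (S.erase b) ?_ (Finset.erase_subset _ _) ?_ (Finset.nonempty_iff_ne_empty.2 hc) ?_
      · intro x hx
        have := hS (Finset.mem_of_mem_erase hx)
        rw [hAB, Finset.mem_insert] at this
        exact this.resolve_left (Finset.ne_of_mem_erase hx)
      · rw [Finset.disjoint_left]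
        intro x hx hxS
        simp only [Finset.mem_sdiff, Finset.mem_erase, not_and_or, not_not] at hx
        rcases hx.2 with rfl | h'
        · exact hb hx.1
        · exact h' hxS
      · intro h'
        apply hS'
        rw [hAB, ← h', Finset.insert_erase hbS]
  · have hSA : S ⊆ A.tiles := by
      intro x hx
      have := hS hx
      rw [hAB, Finset.mem_insert] at this
      exact this.resolve_left (fun e => hbS (e ▸ hx))
    by_cases hc : S = A.tiles
    · have : B.tiles \ S = {b} := by
        rw [hAB, hc, Finset.insert_sdiff_of_notMem _ hb]; simp
      rw [this, hc]
      simpa using h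
    · exact key S hSA subset_rfl Finset.sdiff_disjoint hne hc

end Stability


/-! ### Lifting the assembly process to a chain on explicit states. -/

section Chain

variable {G : Type} {Γ : TileSystem G} {S : Type}

/-- The states `s : S` satisfying `V` represent assemblies `asm s`, and `next s` lists the possible
attachments to `asm s` with the states that they lead to. -/
structure Represents (Γ : TileSystem G) (asm : S → Assembly G)
    (next : S → List (PlacedTile G × S)) (V : S → Prop) : Prop where
  closed : ∀ {s}, V s → ∀ e ∈ next s, V e.2
  attaches : ∀ {s}, V s → ∀ e ∈ next s, Γ.Attaches (asm s) e.1 (asm e.2)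
  frontier : ∀ {s}, V s → ∀ b ∈ Γ.frontier (asm s), ∃ t, (b, t) ∈ next s
  nodup : ∀ {s}, V s → ((next s).map Prod.fst).Nodup

/-- One step of the chain on states, acting on functions. -/
noncomputable def stepOp (P : Concentration Γ.tileSet) (next : S → List (PlacedTile G × S))
    (f : S → ℝ≥0∞) (s : S) : ℝ≥0∞ :=
  ((next s).map fun e => (P.conc e.1.tile : ℝ≥0∞) /
    ((next s).map fun e => (P.conc e.1.tile : ℝ≥0∞)).sum * f e.2).sum

/-- The expectation of `f` after `k` steps of the chain on states started in `s`. -/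
noncomputable def expect (P : Concentration Γ.tileSet) (next : S → List (PlacedTile G × S)) :
    ℕ → (S → ℝ≥0∞) → S → ℝ≥0∞
  | 0, f => f
  | k + 1, f => stepOp P next (expect P next k f)

variable {asm : S → Assembly G} {next : S → List (PlacedTile G × S)} {V : S → Prop}
  (P : Concentration Γ.tileSet)

theorem stepOp_mono (hR : Represents Γ asm next V) {f g : S → ℝ≥0∞} (h : ∀ s, V s → f s ≤ g s)
    {s : S} (hs : V s) : stepOp P next f s ≤ stepOp P next g s := by
  unfold stepOp
  apply List.sum_le_sum
  intro e he
  gcongr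
  exact h _ (hR.closed hs e he)

theorem expect_mono (hR : Represents Γ asm next V) {f g : S → ℝ≥0∞} (h : ∀ s, V s → f s ≤ g s)
    (k : ℕ) {s : S} (hs : V s) : expect P next k f s ≤ expect P next k g s := by
  induction k generalizing s with
  | zero => exact h s hs
  | succ k ih => exact stepOp_mono P hR (fun t ht => ih ht) hs

theorem expect_congr (hR : Represents Γ asm next V) {f g : S → ℝ≥0∞} (h : ∀ s, V s → f s = g s)
    (k : ℕ) {s : S} (hs : V s) : expect P next k f s = expect P next k g s :=
  le_antisymm (expect_mono P hR (fun t ht => (h t ht).le) k hs)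
    (expect_mono P hR (fun t ht => (h t ht).ge) k hs)

/-- `expect` splits off the first step, whereas `law` appends the last one; this reconciles the two.
-/
theorem expect_succ (k : ℕ) (f : S → ℝ≥0∞) :
    expect P next (k + 1) f = expect P next k (stepOp P next f) := by
  induction k with
  | zero => rfl
  | succ k ih => rw [expect, ih]; rfl

theorem tsum_list_sum {ι E : Type} (l : List E) (F : E → ι → ℝ≥0∞) :
    ∑' i, (l.map fun e => F e i).sum = (l.map fun e => ∑' i, F e i).sum := by
  induction l with
  | nil => simp
  | cons a l ih => simp only [List.map_cons, List.sum_cons]; rw [ENNReal.tsum_add, ih]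

theorem stepOp_tsum {ι : Type} (f : ι → S → ℝ≥0∞) (s : S) :
    stepOp P next (fun s => ∑' i, f i s) s = ∑' i, stepOp P next (f i) s := by
  unfold stepOp
  rw [tsum_list_sum]
  simp only [ENNReal.tsum_mul_left]

theorem expect_tsum {ι : Type} (f : ι → S → ℝ≥0∞) (k : ℕ) (s : S) :
    expect P next k (fun s => ∑' i, f i s) s = ∑' i, expect P next k (f i) s := by
  induction k generalizing s with
  | zero => rfl
  | succ k ih =>
    simp only [expect]
    rw [← stepOp_tsum]
    congr 1
    funext t
    exact ih t

theorem stepOp_mul_const (f : S → ℝ≥0∞) (c : ℝ≥0∞) (s : S) :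
    stepOp P next (fun s => f s * c) s = stepOp P next f s * c := by
  unfold stepOp
  rw [← List.sum_map_mul_right]
  simp only [mul_assoc]

theorem expect_mul_const (f : S → ℝ≥0∞) (c : ℝ≥0∞) (k : ℕ) (s : S) :
    expect P next k (fun s => f s * c) s = expect P next k f s * c := by
  induction k generalizing s with
  | zero => rfl
  | succ k ih =>
    simp only [expect]
    rw [← stepOp_mul_const]
    congr 1
    funext t
    exact ih t

theorem stepOp_add (f g : S → ℝ≥0∞) (s : S) :
    stepOp P next (fun s => f s + g s) s = stepOp P next f s + stepOp P next g s := by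
  unfold stepOp
  rw [← List.sum_map_add]
  simp only [mul_add]

theorem expect_add (f g : S → ℝ≥0∞) (k : ℕ) (s : S) :
    expect P next k (fun s => f s + g s) s = expect P next k f s + expect P next k g s := by
  induction k generalizing s with
  | zero => rfl
  | succ k ih =>
    simp only [expect]
    rw [← stepOp_add]
    congr 1
    funext t
    exact ih t

theorem Represents.eq_of_attaches (hR : Represents Γ asm next V) {s : S} (hs : V s)
    {e : PlacedTile G × S} (he : e ∈ next s) {B : Assembly G} (hB : Γ.Attaches (asm s) e.1 B) :
    asm e.2 = B := by
  have h := hR.attaches hs e he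
  exact Assembly.ext (h.2.2.1.trans hB.2.2.1.symm)

open Classical in
theorem tsum_subtype_list {T : Set (PlacedTile G)} {E : Type} (l : List E) (φ : E → PlacedTile G)
    (hl : (l.map φ).Nodup) (hT : ∀ b, b ∈ T ↔ ∃ e ∈ l, φ e = b) (w : PlacedTile G → ℝ≥0∞) :
    ∑' b : T, w b.1 = (l.map fun e => w (φ e)).sum := by
  have : T = ((l.map φ).toFinset : Set (PlacedTile G)) := by
    ext b; simp [hT]
  subst this
  rw [Finset.tsum_subtype' (l.map φ).toFinset w, List.sum_toFinset _ hl, List.map_map]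
  rfl

open Classical in
-- Injectivity of `asm` is not required: all entries leading to `B` are collected, and `nodup` keeps
-- a tile from being counted twice.
theorem Represents.trans_eq (hR : Represents Γ asm next V) {s : S} (hs : V s) (B : Assembly G) :
    TileSystem.trans P (asm s) B = stepOp P next (fun t => if asm t = B then 1 else 0) s := by
  unfold TileSystem.trans stepOp
  have h1 : ∑' b : Γ.frontier (asm s), (P.conc b.1.tile : ℝ≥0∞) =
      ((next s).map fun e => (P.conc e.1.tile : ℝ≥0∞)).sum := by
    refine tsum_subtype_list (next s) Prod.fst (hR.nodup hs) (fun b => ⟨fun hb => ?_, ?_⟩)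
      fun b => (P.conc b.tile : ℝ≥0∞)
    · obtain ⟨t, ht⟩ := hR.frontier hs b hb
      exact ⟨_, ht, rfl⟩
    · rintro ⟨e, he, rfl⟩
      exact ⟨_, hR.attaches hs e he⟩
  have h2 : ∑' b : {b | Γ.Attaches (asm s) b B}, (P.conc b.1.tile : ℝ≥0∞) =
      (((next s).filter fun e => asm e.2 = B).map fun e => (P.conc e.1.tile : ℝ≥0∞)).sum := by
    refine tsum_subtype_list _ Prod.fst ((hR.nodup hs).sublist (List.filter_sublist.map _))
      (fun b => ⟨fun hb => ?_, ?_⟩) fun b => (P.conc b.tile : ℝ≥0∞)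
    · obtain ⟨t, ht⟩ := hR.frontier hs b ⟨B, hb⟩
      refine ⟨(b, t), ?_, rfl⟩
      simp only [List.mem_filter, decide_eq_true_eq]
      exact ⟨ht, hR.eq_of_attaches hs ht hb⟩
    · rintro ⟨e, he, rfl⟩
      simp only [List.mem_filter, decide_eq_true_eq] at he
      exact he.2 ▸ hR.attaches hs e he.1
  rw [h1, h2]
  generalize ((next s).map fun e => (P.conc e.1.tile : ℝ≥0∞)).sum = c
  generalize next s = l
  induction l with
  | nil => simp
  | cons e l ih =>
    by_cases h : asm e.2 = B
    · simp [h, ENNReal.add_div, ih]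
    · simp [h, ih]

open Classical in
theorem Represents.law_eq (hR : Represents Γ asm next V) {s₀ : S} (h₀ : V s₀)
    (hs₀ : asm s₀ = Γ.seed) (k : ℕ) (A : Assembly G) :
    TileSystem.law P k A = expect P next k (fun t => if asm t = A then 1 else 0) s₀ := by
  induction k generalizing A with
  | zero => simp [TileSystem.law, expect, hs₀, eq_comm]
  | succ k ih =>
    rw [TileSystem.law, expect_succ]
    simp only [ih, ← expect_mul_const]
    rw [← expect_tsum]
    refine expect_congr P hR (fun s hs => ?_) k h₀
    rw [← hR.trans_eq P hs A]
    rw [tsum_eq_single (asm s)]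
    · simp
    · intro B hB
      simp [hB.symm]

/-- Weighted sums of terminal probabilities become total expected rewards of the chain on states,
which potentials can bound. -/
theorem Represents.tsum_law (hR : Represents Γ asm next V) {s₀ : S} (h₀ : V s₀)
    (hs₀ : asm s₀ = Γ.seed) (X : Set (Assembly G)) (w : Assembly G → ℝ≥0∞) :
    ∑' A : X, w A.1 * TileSystem.probTerm P A.1 =
      ∑' k, expect P next k (fun t => X.indicator w (asm t)) s₀ := by
  classical
  unfold TileSystem.probTerm
  simp only [← ENNReal.tsum_mul_left]
  rw [ENNReal.tsum_comm]
  congr 1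
  funext k
  simp only [hR.law_eq P h₀ hs₀ k, mul_comm (w _), ← expect_mul_const]
  rw [← expect_tsum]
  congr 1
  funext t
  rw [tsum_subtype X fun A => (if asm t = A then 1 else 0) * w A, tsum_eq_single (asm t)]
  · by_cases h : asm t ∈ X <;> simp [h]
  · intro B hB
    by_cases h : B ∈ X <;> simp [h, hB.symm]

theorem Represents.probOf_eq (hR : Represents Γ asm next V) {s₀ : S} (h₀ : V s₀)
    (hs₀ : asm s₀ = Γ.seed) (X : Set (Assembly G)) :
    TileSystem.probOf P X = ∑' k, expect P next k (fun t => X.indicator 1 (asm t)) s₀ := by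
  rw [← hR.tsum_law P h₀ hs₀ X 1]
  simp [TileSystem.probOf]

theorem Represents.expectedSpace_eq (hR : Represents Γ asm next V) {s₀ : S} (h₀ : V s₀)
    (hs₀ : asm s₀ = Γ.seed) :
    TileSystem.expectedSpace P = ∑' k, expect P next k
      (fun t => Γ.terminal.indicator (fun A => (A.space : ℝ≥0∞)) (asm t)) s₀ := by
  rw [← hR.tsum_law P h₀ hs₀ Γ.terminal fun A => (A.space : ℝ≥0∞)]
  rfl

/-- A superharmonic function dominates the total expected reward. -/
theorem Represents.tsum_expect_le (hR : Represents Γ asm next V) {s₀ : S} (h₀ : V s₀)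
    {f g : S → ℝ≥0∞} (h : ∀ s, V s → stepOp P next f s + g s ≤ f s) :
    ∑' k, expect P next k g s₀ ≤ f s₀ := by
  -- The rewards of the first `K` steps plus the expected value of `f` after them never exceed `f
  -- s₀`.
  have key : ∀ K, ∑ k ∈ Finset.range K, expect P next k g s₀ + expect P next K f s₀ ≤ f s₀ := by
    intro K
    induction K with
    | zero => simp [expect]
    | succ K ih =>
      refine le_trans ?_ ih
      rw [Finset.sum_range_succ, add_assoc, expect_succ, ← expect_add]
      gcongr
      refine expect_mono P hR (fun s hs => ?_) K h₀
      rw [add_comm]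
      exact h s hs
  rw [ENNReal.tsum_eq_iSup_nat]
  exact iSup_le fun K => le_self_add.trans (key K)

theorem stepOp_one (hR : Represents Γ asm next V) {s : S} (hs : V s) (hn : next s ≠ []) :
    stepOp P next 1 s = 1 := by
  unfold stepOp
  simp only [Pi.one_apply, mul_one]
  have h0 : ((next s).map fun e => (P.conc e.1.tile : ℝ≥0∞)).sum ≠ 0 := by
    obtain ⟨e, l, hl⟩ := List.exists_cons_of_ne_nil hn
    have he : 0 < P.conc e.1.tile :=
      P.conc_pos _ (hR.attaches hs e (by rw [hl]; exact List.mem_cons_self)).1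
    rw [hl, List.map_cons, List.sum_cons]
    exact (add_pos_of_pos_of_nonneg (by exact_mod_cast he) (by simp)).ne'
  have h1 : ((next s).map fun e => (P.conc e.1.tile : ℝ≥0∞)).sum ≠ ⊤ := by
    generalize next s = l
    induction l with
    | nil => simp
    | cons a l ih => simp [ih]
  generalize hc : ((next s).map fun e => (P.conc e.1.tile : ℝ≥0∞)).sum = c at *
  have : ((next s).map fun e => (P.conc e.1.tile : ℝ≥0∞) / c).sum = c / c := by
    conv_rhs => rw [← hc]
    simp only [div_eq_mul_inv]
    rw [List.sum_map_mul_right, hc]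
  rw [this, ENNReal.div_self h0 h1]

/-- If the expected number of steps is finite, the chain ends almost surely. -/
theorem Represents.tsum_expect_end (hR : Represents Γ asm next V) {s₀ : S} (h₀ : V s₀)
    {f : S → ℝ≥0∞} (hf : f s₀ ≠ ⊤) (h : ∀ s, V s → next s ≠ [] → stepOp P next f s + 1 ≤ f s) :
    ∑' k, expect P next k (fun s => if next s = [] then 1 else 0) s₀ = 1 := by
  classical
  have hone : ∀ s, V s → stepOp P next 1 s = if next s = [] then 0 else 1 := by
    intro s hs
    split_ifs with hn
    · simp [stepOp, hn]
    · exact stepOp_one P hR hs hn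
  -- The probabilities that a further step follows sum to the expected number of steps, so they tend
  -- to 0.
  have hfin : ∑' k, expect P next k (fun s => if next s = [] then 0 else 1) s₀ ≠ ⊤ := by
    refine ne_top_of_le_ne_top hf (hR.tsum_expect_le P h₀ fun s hs => ?_)
    split_ifs with hn
    · simp [stepOp, hn]
    · exact h s hs hn
  have hlim := ENNReal.tendsto_atTop_zero_of_tsum_ne_top hfin
  -- The chain either ends within fewer than `K` steps or makes at least `K` of them; `expect P next
  -- K 1` is the probability of the latter.
  have hsum : ∀ K, ∑ k ∈ Finset.range K, expect P next k (fun s => if next s = [] then 1 else 0) s₀ +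
      expect P next K 1 s₀ = 1 := by
    intro K
    induction K with
    | zero => simp [expect]
    | succ K ih =>
      rw [Finset.sum_range_succ, add_assoc, expect_succ, ← expect_add]
      refine Eq.trans ?_ ih
      congr 1
      refine expect_congr P hR (fun s hs => ?_) K h₀
      rw [hone s hs]
      split_ifs <;> simp
  have hlim' : Filter.Tendsto (fun K => expect P next K 1 s₀) Filter.atTop (nhds 0) := by
    rw [← Filter.tendsto_add_atTop_iff_nat 1]
    refine hlim.congr fun K => ?_
    rw [expect_succ]
    exact (expect_congr P hR (fun s hs => hone s hs) K h₀).symm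
  have h2 := (ENNReal.tendsto_nat_tsum
    (fun k => expect P next k (fun s => if next s = [] then 1 else 0) s₀)).add hlim'
  simp only [hsum, add_zero] at h2
  exact tendsto_nhds_unique h2 tendsto_const_nhds

theorem Represents.frontier_eq_empty_iff (hR : Represents Γ asm next V) {s : S} (hs : V s) :
    Γ.frontier (asm s) = ∅ ↔ next s = [] := by
  constructor
  · intro h
    rw [List.eq_nil_iff_forall_not_mem]
    intro e he
    have : e.1 ∈ Γ.frontier (asm s) := ⟨_, hR.attaches hs e he⟩
    simp [h] at this
  · intro h
    rw [Set.eq_empty_iff_forall_notMem]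
    intro b hb
    obtain ⟨t, ht⟩ := hR.frontier hs b hb
    simp [h] at ht

/-- A state is reachable if it arises from `s₀` by the listed attachments. -/
def Reach (next : S → List (PlacedTile G × S)) (s₀ s : S) : Prop :=
  Relation.ReflTransGen (fun s t => ∃ b, (b, t) ∈ next s) s₀ s

theorem Represents.of_reach (hR : Represents Γ asm next V) {s t : S} (hs : V s)
    (h : Reach next s t) : V t ∧ Γ.Grows (asm s) (asm t) := by
  induction h with
  | refl => exact ⟨hs, Relation.ReflTransGen.refl⟩
  | tail _ h ih =>
    obtain ⟨b, hb⟩ := h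
    exact ⟨hR.closed ih.1 _ hb, ih.2.tail ⟨b, hR.attaches ih.1 _ hb⟩⟩

theorem Represents.exists_of_grows (hR : Represents Γ asm next V) {s : S} (hs : V s)
    {A : Assembly G} (h : Γ.Grows (asm s) A) : ∃ t, asm t = A ∧ Reach next s t := by
  induction h with
  | refl => exact ⟨s, rfl, Relation.ReflTransGen.refl⟩
  | tail _ h ih =>
    obtain ⟨t, rfl, ht⟩ := ih
    obtain ⟨b, hb⟩ := h
    obtain ⟨u, hu⟩ := hR.frontier (hR.of_reach hs ht).1 b ⟨_, hb⟩
    exact ⟨u, hR.eq_of_attaches (hR.of_reach hs ht).1 hu hb, ht.tail ⟨b, hu⟩⟩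

end Chain


/-! ### The geometry of one gadget and its finite verification. -/

/-- Codes of the glues on the four edges of a tile. -/
structure Sides where
  north : ℕ
  east : ℕ
  south : ℕ
  west : ℕ
  deriving DecidableEq, Inhabited

/-- A tile in the coordinate system of one gadget: its kind `n`, the tag `t` of the state to which it
belongs (`1` for the state of the gadget, `2` for the next state), its position, and its glues, where
`4 * c + t` stands for the glue `c` with tag `t`. -/
structure Item where
  n : ℕ
  t : ℕ
  x : ℕ
  y : ℕ
  sides : Sides
  deriving DecidableEq, Inhabited

/-- The glues of the tile kinds. The kinds `0` to `4` take part in the race, `5` to `10` report its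
outcome, `11` is the seed, `12` and `13` are the exits, and the kinds from `14` on form the path. -/
def glueTable : List Sides :=
  [⟨5, 1, 2, 1⟩, ⟨4, 1, 3, 1⟩, ⟨14, 7, 4, 6⟩, ⟨15, 8, 4, 7⟩, ⟨9, 6, 5, 8⟩,
   ⟨0, 10, 14, 0⟩, ⟨0, 0, 15, 11⟩, ⟨12, 0, 9, 10⟩, ⟨16, 11, 9, 0⟩, ⟨0, 17, 16, 0⟩,
   ⟨0, 13, 0, 17⟩, ⟨0, 26, 0, 0⟩, ⟨19, 18, 12, 0⟩, ⟨19, 18, 0, 13⟩, ⟨0, 20, 19, 0⟩,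
   ⟨0, 21, 0, 20⟩, ⟨0, 22, 0, 21⟩, ⟨0, 23, 0, 22⟩, ⟨0, 24, 0, 23⟩, ⟨0, 0, 25, 24⟩,
   ⟨25, 26, 0, 0⟩, ⟨0, 27, 0, 26⟩, ⟨0, 28, 0, 27⟩, ⟨0, 0, 29, 28⟩, ⟨29, 0, 0, 30⟩,
   ⟨0, 30, 0, 31⟩, ⟨0, 31, 32, 0⟩, ⟨32, 6, 33, 0⟩, ⟨33, 0, 34, 0⟩, ⟨34, 35, 0, 0⟩,
   ⟨3, 36, 0, 35⟩, ⟨3, 37, 0, 36⟩, ⟨2, 0, 38, 37⟩, ⟨38, 39, 0, 0⟩, ⟨0, 40, 0, 39⟩,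
   ⟨0, 41, 0, 40⟩, ⟨0, 42, 0, 41⟩, ⟨0, 43, 0, 42⟩, ⟨0, 44, 0, 43⟩, ⟨45, 0, 0, 44⟩,
   ⟨46, 0, 45, 0⟩, ⟨47, 0, 46, 0⟩, ⟨48, 0, 47, 0⟩, ⟨49, 0, 48, 0⟩, ⟨0, 0, 49, 50⟩,
   ⟨0, 50, 0, 51⟩, ⟨0, 51, 0, 52⟩, ⟨0, 52, 53, 18⟩, ⟨53, 54, 0, 0⟩, ⟨0, 55, 0, 54⟩,
   ⟨0, 0, 56, 55⟩, ⟨56, 0, 57, 8⟩, ⟨57, 0, 58, 0⟩, ⟨58, 0, 0, 59⟩, ⟨3, 59, 0, 60⟩,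
   ⟨3, 60, 0, 61⟩, ⟨2, 61, 0, 62⟩, ⟨63, 62, 0, 0⟩, ⟨4, 1, 63, 1⟩]

/-- The frame of a gadget, in the order of attachment. -/
def frameItems : List Item :=
  [⟨21, 1, 1, 6, ⟨0, 109, 0, 105⟩⟩, ⟨22, 1, 2, 6, ⟨0, 113, 0, 109⟩⟩, ⟨23, 1, 3, 6, ⟨0, 0, 117, 113⟩⟩,
   -- The frame tiles in row 5 cover the glues 14 and 15 on the north sides of the arms, so that a
   -- report can only start above the claimed cell (5, 4).
   ⟨24, 1, 3, 5, ⟨117, 0, 0, 121⟩⟩, ⟨25, 1, 2, 5, ⟨0, 121, 0, 125⟩⟩, ⟨26, 1, 1, 5, ⟨0, 125, 129, 0⟩⟩,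
   ⟨27, 1, 1, 4, ⟨129, 24, 133, 0⟩⟩, ⟨28, 1, 1, 3, ⟨133, 0, 137, 0⟩⟩, ⟨29, 1, 1, 2, ⟨137, 141, 0, 0⟩⟩,
   ⟨30, 1, 2, 2, ⟨12, 145, 0, 141⟩⟩, ⟨31, 1, 3, 2, ⟨12, 149, 0, 145⟩⟩, ⟨32, 1, 4, 2, ⟨8, 0, 153, 149⟩⟩,
   ⟨33, 1, 4, 1, ⟨153, 157, 0, 0⟩⟩, ⟨34, 1, 5, 1, ⟨0, 161, 0, 157⟩⟩, ⟨35, 1, 6, 1, ⟨0, 165, 0, 161⟩⟩,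
   ⟨36, 1, 7, 1, ⟨0, 169, 0, 165⟩⟩, ⟨37, 1, 8, 1, ⟨0, 173, 0, 169⟩⟩, ⟨38, 1, 9, 1, ⟨0, 177, 0, 173⟩⟩,
   ⟨39, 1, 10, 1, ⟨181, 0, 0, 177⟩⟩, ⟨40, 1, 10, 2, ⟨185, 0, 181, 0⟩⟩, ⟨41, 1, 10, 3, ⟨189, 0, 185, 0⟩⟩,
   ⟨42, 1, 10, 4, ⟨193, 0, 189, 0⟩⟩, ⟨43, 1, 10, 5, ⟨197, 0, 193, 0⟩⟩, ⟨44, 1, 10, 6, ⟨0, 0, 197, 201⟩⟩,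
   ⟨45, 1, 9, 6, ⟨0, 201, 0, 205⟩⟩, ⟨46, 1, 8, 6, ⟨0, 205, 0, 209⟩⟩, ⟨47, 1, 7, 6, ⟨0, 209, 213, 73⟩⟩,
   ⟨48, 1, 7, 5, ⟨213, 217, 0, 0⟩⟩, ⟨49, 1, 8, 5, ⟨0, 221, 0, 217⟩⟩, ⟨50, 1, 9, 5, ⟨0, 0, 225, 221⟩⟩,
   ⟨51, 1, 9, 4, ⟨225, 0, 229, 32⟩⟩, ⟨52, 1, 9, 3, ⟨229, 0, 233, 0⟩⟩, ⟨53, 1, 9, 2, ⟨233, 0, 0, 237⟩⟩,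
   ⟨54, 1, 8, 2, ⟨12, 237, 0, 241⟩⟩, ⟨55, 1, 7, 2, ⟨12, 241, 0, 245⟩⟩, ⟨56, 1, 6, 2, ⟨8, 245, 0, 249⟩⟩,
   ⟨57, 1, 5, 2, ⟨253, 249, 0, 0⟩⟩, ⟨58, 1, 5, 3, ⟨16, 4, 253, 4⟩⟩]

/-- The tiles that lead to the next gadget. -/
def tailItems : List Item :=
  [⟨14, 2, 6, 7, ⟨0, 82, 78, 0⟩⟩, ⟨15, 2, 7, 7, ⟨0, 86, 0, 82⟩⟩, ⟨16, 2, 8, 7, ⟨0, 90, 0, 86⟩⟩,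
   ⟨17, 2, 9, 7, ⟨0, 94, 0, 90⟩⟩, ⟨18, 2, 10, 7, ⟨0, 98, 0, 94⟩⟩, ⟨19, 2, 11, 7, ⟨0, 0, 102, 98⟩⟩,
   ⟨20, 2, 11, 6, ⟨102, 106, 0, 0⟩⟩]

/-- The left arm of the race. -/
def leftItems : List Item :=
  [⟨0, 1, 4, 3, ⟨20, 4, 8, 4⟩⟩, ⟨1, 1, 3, 3, ⟨16, 4, 12, 4⟩⟩, ⟨1, 1, 2, 3, ⟨16, 4, 12, 4⟩⟩,
   ⟨2, 1, 2, 4, ⟨56, 28, 16, 24⟩⟩, ⟨3, 1, 3, 4, ⟨60, 32, 16, 28⟩⟩, ⟨4, 1, 4, 4, ⟨36, 24, 20, 32⟩⟩]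

/-- The right arm of the race. -/
def rightItems : List Item :=
  [⟨0, 1, 6, 3, ⟨20, 4, 8, 4⟩⟩, ⟨1, 1, 7, 3, ⟨16, 4, 12, 4⟩⟩, ⟨1, 1, 8, 3, ⟨16, 4, 12, 4⟩⟩,
   ⟨3, 1, 8, 4, ⟨60, 32, 16, 28⟩⟩, ⟨2, 1, 7, 4, ⟨56, 28, 16, 24⟩⟩, ⟨4, 1, 6, 4, ⟨36, 24, 20, 32⟩⟩]

/-- The tiles that claim and report a victory of the left arm. -/
def claimLeftItems : List Item :=
  [⟨2, 1, 5, 4, ⟨56, 28, 16, 24⟩⟩, ⟨5, 1, 5, 5, ⟨0, 40, 56, 0⟩⟩, ⟨7, 1, 6, 5, ⟨48, 0, 36, 40⟩⟩,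
   ⟨12, 1, 6, 6, ⟨78, 73, 48, 0⟩⟩]

/-- The tiles that claim and report a victory of the right arm. -/
def claimRightItems : List Item :=
  [⟨3, 1, 5, 4, ⟨60, 32, 16, 28⟩⟩, ⟨6, 1, 5, 5, ⟨0, 0, 60, 44⟩⟩, ⟨8, 1, 4, 5, ⟨64, 44, 36, 0⟩⟩,
   ⟨9, 1, 4, 6, ⟨0, 68, 64, 0⟩⟩, ⟨10, 1, 5, 6, ⟨0, 52, 0, 68⟩⟩, ⟨13, 1, 6, 6, ⟨78, 73, 0, 52⟩⟩]

/-- The tile from which the frame grows. -/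
def entryItem : Item := ⟨11, 1, 0, 6, ⟨0, 105, 0, 0⟩⟩

/-- The strength of the glue with code `c`. -/
def codeStrength (c : ℕ) : ℕ :=
  -- Code 18 is the only weak glue that carries a state: an exit needs it together with the glue 12
  -- or 13 that announces the outcome.
  if c = 0 then 0 else if c < 14 then 1 else if c = 18 then 1 else 2

/-- The glues of a tile of kind `n` with tags `t` for its state and `t'` for the state it leads to. -/
def tagGlue (n t t' c : ℕ) : ℕ :=
  if c < 18 then 4 * c
  else if c = 19 ∧ (n = 12 ∨ n = 13) then 4 * c + t' else 4 * c + t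

def tagSides (n t t' : ℕ) (s : Sides) : Sides :=
  ⟨tagGlue n t t' s.north, tagGlue n t t' s.east, tagGlue n t t' s.south, tagGlue n t t' s.west⟩

/-- The items of the outcome `o` of the race. -/
def claimItems (o : Bool) : List Item :=
  (bif o then claimLeftItems else claimRightItems) ++ tailItems

/-- The progress within a gadget: the numbers of tiles of the frame, the left arm, the right arm and
the part that follows the outcome `o` of the race. -/
structure Progress where
  p : ℕ
  i : ℕ
  j : ℕ
  o : Bool
  m : ℕ
  deriving DecidableEq

def Progress.items (σ : Progress) : List Item :=
  frameItems.take σ.p ++ leftItems.take σ.i ++ rightItems.take σ.j ++ (claimItems σ.o).take σ.m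

/-- The seventh step of an arm is the claim of the cell (5, 4). -/
def Progress.leftNext (σ : Progress) : Item × Progress :=
  if σ.i < 6 then (leftItems.getD σ.i default, { σ with i := σ.i + 1 })
  else ((claimItems true).getD 0 default, { σ with o := true, m := 1 })

def Progress.rightNext (σ : Progress) : Item × Progress :=
  if σ.j < 6 then (rightItems.getD σ.j default, { σ with j := σ.j + 1 })
  else ((claimItems false).getD 0 default, { σ with o := false, m := 1 })

/-- The possible attachments, with the progress after them. -/
def Progress.next (σ : Progress) : List (Item × Progress) :=
  if σ.p < 38 then [(frameItems.getD σ.p default, { σ with p := σ.p + 1 })]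
  else if σ.m = 0 then [σ.leftNext, σ.rightNext]
  -- The winner's arm is complete, so an unfinished left arm is the loser's. The report tile with
  -- index 2 needs glue 9 from the last tile of the losing arm, which is why the report pauses at `m
  -- = 2`.
  else if σ.i < 6 then
    if σ.m = 1 then [((claimItems σ.o).getD 1 default, { σ with m := 2 }), σ.leftNext]
    else [σ.leftNext]
  else if σ.j < 6 then
    if σ.m = 1 then [((claimItems σ.o).getD 1 default, { σ with m := 2 }), σ.rightNext]
    else [σ.rightNext]
  else if σ.m < (claimItems σ.o).length then
    [((claimItems σ.o).getD σ.m default, { σ with m := σ.m + 1 })]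
  else []

/-- The bond between the item `u` and a tile with the glues `s` at `(x, y)`. -/
def itemBond (u : Item) (s : Sides) (x y : ℕ) : ℕ :=
  if u.y.beq y then
    if (u.x + 1).beq x then if u.sides.east.beq s.west then codeStrength (s.west / 4) else 0
    else if u.x.beq (x + 1) then if u.sides.west.beq s.east then codeStrength (s.east / 4) else 0
    else 0
  else if u.x.beq x then
    if (u.y + 1).beq y then if u.sides.north.beq s.south then codeStrength (s.south / 4) else 0
    else if u.y.beq (y + 1) then if u.sides.south.beq s.north then codeStrength (s.north / 4) else 0
    else 0
  else 0

def itemSum (l : List Item) (s : Sides) (x y : ℕ) : ℕ :=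
  l.foldr (fun u r => itemBond u s x y + r) 0

def isOcc (l : List Item) (x y : ℕ) : Bool := l.any fun u => u.x.beq x && u.y.beq y

/-- No tile can attach at the position `(x, y)` by a glue `g` on its side `sel`, except those
of `front`. -/
def exposureOk (l front : List Item) (x y g : ℕ) (sel : Sides → ℕ) : Bool :=
  Nat.blt g 4 || isOcc l x y || (Nat.ble 1 x && (glueTable.zipIdx).all fun r =>
    !(sel r.1).beq (g / 4) ||
    -- Kinds below 11 are stateless, and only the exits 12 and 13 involve a second state; for other
    -- kinds the tags need not vary.
    (if r.2 < 11 then [1] else [1, 2, 3]).all fun t =>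
    (if r.2 = 12 ∨ r.2 = 13 then [1, 2, 3] else [1]).all fun t' =>
    !(tagGlue r.2 t t' (sel r.1)).beq g || Nat.ble (itemSum l (tagSides r.2 t t' r.1) x y) 1 ||
      front.any fun f => f.n.beq r.2 && (Nat.blt r.2 11 || f.t.beq t) && f.x.beq x && f.y.beq y)

/-- Glues below 4 have code 0 and are inert. The guards on the last two sides keep the truncated
subtractions harmless. -/
def exposuresOk (l front : List Item) (u : Item) : Bool :=
  exposureOk l front (u.x + 1) u.y u.sides.east Sides.west &&
  exposureOk l front u.x (u.y + 1) u.sides.north Sides.south &&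
  (Nat.blt u.sides.west 4 || Nat.ble 1 u.x && exposureOk l front (u.x - 1) u.y u.sides.west Sides.east) &&
  (Nat.blt u.sides.south 4 || Nat.ble 1 u.y && exposureOk l front u.x (u.y - 1) u.sides.south Sides.north)

/-- The progress values that occur while a gadget grows. -/
def progressStates : List Progress :=
  -- Before a claim the outcome has the default value `true`. Complete gadgets (`m = 11` or `m =
  -- 13`) are absent, as they count as the beginning of the next gadget.
  (List.range 38).map (fun p => ⟨p, 0, 0, true, 0⟩) ++
  (List.range 7).flatMap (fun i => (List.range 7).map fun j => ⟨38, i, j, true, 0⟩) ++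
  (List.range 7).flatMap (fun j => [⟨38, 6, j, true, 1⟩, ⟨38, 6, j, true, 2⟩,
    ⟨38, j, 6, false, 1⟩, ⟨38, j, 6, false, 2⟩]) ++
  (List.range' 3 8).map (fun m => ⟨38, 6, 6, true, m⟩) ++
  (List.range' 3 10).map (fun m => ⟨38, 6, 6, false, m⟩)

/-- The tiles of a complete gadget with outcome `o`. -/
def fullItems (o : Bool) : List Item :=
  frameItems ++ leftItems ++ rightItems ++ claimItems o

/-- One half excludes every unlisted attachment, the other confirms the listed ones. The entry tile
is included because it belongs to the preceding gadget but bonds with this one. -/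
def Progress.check (σ : Progress) : Bool :=
  let l := entryItem :: σ.items
  l.all (exposuresOk l (σ.next.map Prod.fst)) &&
  (σ.next.map Prod.fst).all fun f => !isOcc l f.x f.y && Nat.ble 2 (itemSum l f.sides f.x f.y)

theorem check_progressStates : (progressStates.all Progress.check) = true := by
  decide +kernel

/-- The tile that a complete gadget admits to its right. -/
def exitItem : Item := ⟨21, 2, 12, 6, ⟨0, 0, 0, 0⟩⟩

theorem exposuresOk_fullItems (o : Bool) :
    (entryItem :: fullItems o).all (exposuresOk (entryItem :: fullItems o) [exitItem]) = true := by
  cases o <;> decide +kernel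

/-- The glues of an item are those of its kind, where the next state belongs to the outcome `o`. -/
def Item.consistent (o : Bool) (u : Item) : Bool :=
  Nat.blt u.n 59 && (Nat.beq u.t 1 || Nat.beq u.t 2 && Nat.blt 13 u.n) &&
  decide (u.sides = tagSides u.n u.t 2 (glueTable.getD u.n default)) &&
  (!Nat.beq u.n 12 || o) && (!Nat.beq u.n 13 || !o) && Nat.ble u.x 11

theorem consistent_fullItems (o : Bool) :
    (entryItem :: fullItems o).all (Item.consistent o) = true := by
  cases o <;> decide +kernel

theorem nodup_fullItems (o : Bool) :
    ((entryItem :: fullItems o).map fun u => (u.x, u.y)).Nodup := by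
  cases o <;> decide +kernel

/-- The last tile of a gadget. -/
def lastItem : Item := ⟨20, 2, 11, 6, ⟨102, 106, 0, 0⟩⟩

/-- Only the last tile can bond across the eastern boundary of the gadget. -/
theorem fullItems_eq (o : Bool) : fullItems o = (fullItems o).dropLast ++ [lastItem] ∧
    ∀ u ∈ (fullItems o).dropLast, u.x < 11 ∨ u.sides.east = 0 := by
  cases o <;> decide +kernel

theorem one_le_fullItems (o : Bool) : ∀ u ∈ fullItems o, 1 ≤ u.x := by
  cases o <;> decide +kernel

/-- The recorded outcome changes only at a claim, when the new tile does not yet depend on the next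
state. -/
theorem consistent_next : ∀ σ ∈ progressStates, ∀ e ∈ σ.next,
    e.1.consistent σ.o = true ∧ 1 ≤ e.1.x ∧ (e.2.o = σ.o ∨ σ.m = 0 ∧ e.1.t = 1) := by
  decide +kernel

theorem next_mem : ∀ σ ∈ progressStates, ∀ e ∈ σ.next,
    e.2 ∈ progressStates ∨ e.2 = ⟨38, 6, 6, σ.o, (claimItems σ.o).length⟩ ∧ e.1.t = 2 := by
  decide +kernel

/-- Positions alone do not suffice: when both arms are complete, two tiles compete for the cell (5,
4), and their north glues 14 and 15 tell them apart. -/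
theorem nodup_next : ∀ σ ∈ progressStates,
    (σ.next.map fun e => (e.1.x, e.1.y, e.1.sides.north / 4)).Nodup := by
  decide +kernel


/-! ### From the finite checks to statements about arbitrary attaching tiles. -/

section Items

theorem codeStrength_pos {c : ℕ} (h : 0 < codeStrength c) : 0 < c := by
  rcases Nat.eq_zero_or_pos c with rfl | h'
  · simp [codeStrength] at h
  · exact h'

theorem itemBond_pos {u : Item} {s : Sides} {x y : ℕ} (h : 0 < itemBond u s x y) :
    (x = u.x + 1 ∧ y = u.y ∧ u.sides.east = s.west ∧ 4 ≤ s.west) ∨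
    (u.x = x + 1 ∧ y = u.y ∧ u.sides.west = s.east ∧ 4 ≤ s.east) ∨
    (x = u.x ∧ y = u.y + 1 ∧ u.sides.north = s.south ∧ 4 ≤ s.south) ∨
    (x = u.x ∧ u.y = y + 1 ∧ u.sides.south = s.north ∧ 4 ≤ s.north) := by
  unfold itemBond at h
  simp only [Nat.beq_eq] at h
  split_ifs at h with h1 h2 h3 h4 h5 h6 h7 h8 h9
  all_goals first
    | exact absurd h (lt_irrefl _)
    | (have := codeStrength_pos h
       omega)

theorem tagGlue_of_ne {n : ℕ} (h1 : n ≠ 12) (h2 : n ≠ 13) (t t' t'' c : ℕ) :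
    tagGlue n t t' c = tagGlue n t t'' c := by
  simp [tagGlue, h1, h2]

theorem tagSides_of_ne {n : ℕ} (h1 : n ≠ 12) (h2 : n ≠ 13) (t t' t'' : ℕ) (s : Sides) :
    tagSides n t t' s = tagSides n t t'' s := by
  simp only [tagSides, tagGlue_of_ne h1 h2 t t' t'']

/-- Race and report tiles carry no state and are shared by all gadgets; this makes the races
identically distributed. -/
theorem untagged : ∀ n < 11, (glueTable.getD n default).north < 18 ∧
    (glueTable.getD n default).east < 18 ∧ (glueTable.getD n default).south < 18 ∧
    (glueTable.getD n default).west < 18 := by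
  decide

theorem tagSides_of_lt {n : ℕ} (h : n < 11) (t t' t'' t''' : ℕ) :
    tagSides n t t' (glueTable.getD n default) = tagSides n t'' t''' (glueTable.getD n default) := by
  obtain ⟨h1, h2, h3, h4⟩ := untagged n h
  simp only [tagSides, tagGlue, h1, h2, h3, h4, if_true]

theorem isOcc_iff {l : List Item} {x y : ℕ} :
    isOcc l x y = true ↔ ∃ u ∈ l, u.x = x ∧ u.y = y := by
  simp [isOcc, Nat.beq_eq]

theorem exposureOk_spec {l front : List Item} {x y n t t' : ℕ} {sel : Sides → ℕ} (hn : n < 59)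
    (ht : t ∈ [1, 2, 3]) (ht' : t' ∈ [1, 2, 3])
    (hsel : ∀ t t' s, sel (tagSides n t t' s) = tagGlue n t t' (sel s))
    (hg : 4 ≤ sel (tagSides n t t' (glueTable.getD n default)))
    (h : exposureOk l front x y (sel (tagSides n t t' (glueTable.getD n default))) sel = true)
    (hocc : ∀ u ∈ l, ¬ (u.x = x ∧ u.y = y)) :
    1 ≤ x ∧ (itemSum l (tagSides n t t' (glueTable.getD n default)) x y ≤ 1 ∨
      ∃ f ∈ front, f.n = n ∧ (n < 11 ∨ f.t = t) ∧ f.x = x ∧ f.y = y) := by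
  have hocc' : isOcc l x y = false := by
    rw [← Bool.not_eq_true, isOcc_iff]
    rintro ⟨u, hu, h'⟩
    exact hocc u hu h'
  generalize hs : tagSides n t t' (glueTable.getD n default) = s at *
  have hblt : Nat.blt (sel s) 4 = false := by
    rw [← Bool.not_eq_true]
    simp only [Nat.blt, Nat.ble_eq]
    omega
  simp only [exposureOk, hblt, hocc', Bool.false_or, Bool.and_eq_true, List.all_eq_true,
    Nat.ble_eq] at h
  refine ⟨h.1, ?_⟩
  have hlen : glueTable.length = 59 := by decide
  have hrow := h.2 (glueTable.getD n default, n) (by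
    rw [List.mem_zipIdx_iff_getElem?, List.getD_eq_getElem _ _ (by omega)]
    exact List.getElem?_eq_getElem _)
  simp only [Bool.or_eq_true, List.all_eq_true, List.any_eq_true, Bool.not_eq_true',
    Nat.ble_eq, Bool.and_eq_true, Nat.beq_eq] at hrow
  -- The check runs over reduced lists of tags, so the true tags are replaced by listed ones that
  -- give the same sides.
  obtain ⟨τ, hτ, τ', hτ', hss, hor⟩ : ∃ τ ∈ (if n < 11 then [1] else [1, 2, 3] : List ℕ),
      ∃ τ' ∈ (if n = 12 ∨ n = 13 then [1, 2, 3] else [1] : List ℕ),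
      tagSides n τ τ' (glueTable.getD n default) = s ∧ (n < 11 ∨ τ = t) := by
    by_cases h11 : n < 11
    · refine ⟨1, by simp [h11], 1, ?_, ?_, Or.inl h11⟩
      · rw [if_neg (by omega)]; simp
      · rw [← hs]; exact tagSides_of_lt h11 _ _ _ _
    · refine ⟨t, by rw [if_neg h11]; exact ht, ?_⟩
      by_cases h12 : n = 12 ∨ n = 13
      · exact ⟨t', by rw [if_pos h12]; exact ht', hs, Or.inr rfl⟩
      · refine ⟨1, by rw [if_neg h12]; simp, ?_, Or.inr rfl⟩
        rw [← hs]; exact tagSides_of_ne (by omega) (by omega) _ _ _ _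
  have hsel' : tagGlue n τ τ' (sel (glueTable.getD n default)) = sel s := by
    rw [← hsel, hss]
  have hcode : sel (glueTable.getD n default) = sel s / 4 := by
    rw [← hs, hsel]
    have h3 : t ≤ 3 ∧ t' ≤ 3 := by
      simp only [List.mem_cons, List.not_mem_nil, or_false] at ht ht'
      omega
    unfold tagGlue
    split_ifs <;> omega
  rcases hrow with hrow | hrow
  · rw [← Bool.not_eq_true, Nat.beq_eq] at hrow
    exact absurd hcode hrow
  · rcases hrow τ hτ τ' hτ' with (hr | hr) | ⟨f, hf, hr⟩
    · rw [← Bool.not_eq_true, Nat.beq_eq] at hr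
      exact absurd hsel' hr
    · left; rwa [hss] at hr
    · right
      refine ⟨f, hf, hr.1.1.1, ?_, hr.1.2, hr.2⟩
      rcases hor with h11 | rfl
      · exact Or.inl h11
      · rcases hr.1.1.2 with h' | h'
        · left; simpa [Nat.blt, Nat.ble_eq] using h'
        · exact Or.inr h'

/-- If the exposed glues of `l` are fine, then only the items of `front` can attach. -/
theorem le_one_or_front {l front : List Item} (hl : ∀ u ∈ l, exposuresOk l front u = true)
    {x y n t t' : ℕ} (hn : n < 59) (ht : t ∈ [1, 2, 3]) (ht' : t' ∈ [1, 2, 3])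
    (hocc : ∀ u ∈ l, ¬ (u.x = x ∧ u.y = y)) {u : Item} (hu : u ∈ l)
    (hpos : 0 < itemBond u (tagSides n t t' (glueTable.getD n default)) x y) :
    1 ≤ x ∧ (itemSum l (tagSides n t t' (glueTable.getD n default)) x y ≤ 1 ∨
      ∃ f ∈ front, f.n = n ∧ (n < 11 ∨ f.t = t) ∧ f.x = x ∧ f.y = y) := by
  have h := hl u hu
  simp only [exposuresOk, Bool.and_eq_true, Bool.or_eq_true, Nat.blt, Nat.ble_eq] at h
  obtain ⟨⟨⟨hE, hN⟩, hW⟩, hS⟩ := h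
  rcases itemBond_pos hpos with ⟨rfl, rfl, hg, h4⟩ | ⟨hx, rfl, hg, h4⟩ | ⟨rfl, rfl, hg, h4⟩ |
    ⟨rfl, hy, hg, h4⟩
  · rw [hg] at hE
    exact exposureOk_spec (sel := Sides.west) hn ht ht' (fun t t' s => rfl) h4 hE hocc
  · rw [hg] at hW
    rcases hW with hW | hW
    · omega
    · have h2 := hW.2
      rw [hx, Nat.add_sub_cancel] at h2
      exact exposureOk_spec (sel := Sides.east) hn ht ht' (fun t t' s => rfl) h4 h2 hocc
  · rw [hg] at hN
    exact exposureOk_spec (sel := Sides.south) hn ht ht' (fun t t' s => rfl) h4 hN hocc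
  · rw [hg] at hS
    rcases hS with hS | hS
    · omega
    · have h2 := hS.2
      rw [hy, Nat.add_sub_cancel] at h2
      exact exposureOk_spec (sel := Sides.north) hn ht ht' (fun t t' s => rfl) h4 h2 hocc

end Items


/-! ### Machines and their tiles. -/

/-- An automaton that reads bits; it has halted once its state is not in `states`. -/
structure Machine (Q : Type) where
  δ : Q → Bool → Q
  states : Finset Q
  start : Q
  start_mem : start ∈ states
  -- Consecutive states differ, so that the tags 1 and 2 are not confused.
  δ_ne : ∀ q o, δ q o ≠ q

/-- A glue: its code and the state that it carries, if any. -/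
abbrev Glue (Q : Type) := ℕ × Option Q

def glueStrength {Q : Type} (g : Glue Q) : ℕ := codeStrength g.1

section Bond

variable {G : Type} {str : G → ℕ} {a a' b : PlacedTile G}

theorem bond_pos (h : 0 < bond str a b) :
    (b.pos = a.pos + (1, 0) ∧ a.tile.east = b.tile.west ∧ 0 < str a.tile.east) ∨
    (b.pos = a.pos + (-1, 0) ∧ a.tile.west = b.tile.east ∧ 0 < str a.tile.west) ∨
    (b.pos = a.pos + (0, 1) ∧ a.tile.north = b.tile.south ∧ 0 < str a.tile.north) ∨
    (b.pos = a.pos + (0, -1) ∧ a.tile.south = b.tile.north ∧ 0 < str a.tile.south) := by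
  unfold bond at h
  split_ifs at h with h1 h2 h3 h4
  · exact Or.inl ⟨h1.1, h1.2, h⟩
  · exact Or.inr (Or.inl ⟨h2.1, h2.2, h⟩)
  · exact Or.inr (Or.inr (Or.inl ⟨h3.1, h3.2, h⟩))
  · exact Or.inr (Or.inr (Or.inr ⟨h4.1, h4.2, h⟩))
  · exact absurd h (lt_irrefl _)

theorem bond_pos_of_lt (h : 0 < bond str a b) (hx : a.pos.1 < b.pos.1) :
    b.pos = a.pos + (1, 0) ∧ a.tile.east = b.tile.west ∧ 0 < str a.tile.east := by
  rcases bond_pos h with h | h | h | h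
  · exact h
  all_goals
    have := congrArg Prod.fst h.1
    simp at this
    omega

theorem bond_eq_zero_of_lt (hx : a.pos.1 < b.pos.1) (h : a.pos.1 + 1 < b.pos.1 ∨ str a.tile.east = 0) :
    bond str a b = 0 := by
  by_contra hne
  obtain ⟨h1, -, h3⟩ := bond_pos_of_lt (Nat.pos_of_ne_zero hne) hx
  have := congrArg Prod.fst h1
  simp at this
  omega

theorem bond_le_of_east (hpos : a.pos = a'.pos) (he : a.tile.east = a'.tile.east)
    (hx : a.pos.1 < b.pos.1) : bond str a b ≤ bond str a' b := by
  rcases Nat.eq_zero_or_pos (bond str a b) with h0 | h0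
  · omega
  · obtain ⟨h1, h2, -⟩ := bond_pos_of_lt h0 hx
    apply le_of_eq
    unfold bond
    rw [if_pos ⟨h1, h2⟩, if_pos ⟨hpos ▸ h1, he ▸ h2⟩, he]

end Bond

section Tiles

variable {Q : Type} [DecidableEq Q] (M : Machine Q)

/-- The glue with code `c` on a tile of kind `n` for the state `r`. -/
def Machine.glue (n : ℕ) (r : Q) (c : ℕ) : Glue Q :=
  if c < 18 then (c, none)
  else if c = 19 ∧ (n = 12 ∨ n = 13) then (c, some (M.δ r (decide (n = 12)))) else (c, some r)

/-- The tile of kind `n` for the state `r`. -/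
def Machine.tile (n : ℕ) (r : Q) : Tile (Glue Q) :=
  ⟨M.glue n r (glueTable.getD n default).north, M.glue n r (glueTable.getD n default).east,
    M.glue n r (glueTable.getD n default).south, M.glue n r (glueTable.getD n default).west, default⟩

/-- Tag 3 lumps together all states foreign to the gadget, which makes a check over three tags
sufficient for every machine. -/
def stateTag (q q' r : Q) : ℕ := if r = q then 1 else if r = q' then 2 else 3

/-- The code of a glue in a gadget for the state `q` with next state `q'`. -/
def glueCode (q q' : Q) (g : Glue Q) : ℕ := 4 * g.1 + (g.2.elim 0 (stateTag q q'))

def tileSides (q q' : Q) (t : Tile (Glue Q)) : Sides :=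
  ⟨glueCode q q' t.north, glueCode q q' t.east, glueCode q q' t.south, glueCode q q' t.west⟩

/-- The tile of the item `u` in the gadget number `k`, for the state `q` with next state `q'`. -/
def Machine.place (q q' : Q) (k : ℕ) (u : Item) : PlacedTile (Glue Q) :=
  ⟨M.tile u.n (if u.t = 1 then q else q'), ((11 * k + u.x : ℕ), (u.y : ℕ))⟩

theorem stateTag_mem (q q' r : Q) : stateTag q q' r ∈ [1, 2, 3] := by
  unfold stateTag; split_ifs <;> simp

theorem stateTag_le (q q' r : Q) : stateTag q q' r ≤ 3 := by
  unfold stateTag; split_ifs <;> simp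

theorem stateTag_eq_one {q q' r : Q} : stateTag q q' r = 1 ↔ r = q := by
  unfold stateTag; split_ifs <;> simp_all

theorem stateTag_eq_two {q q' r : Q} (h : stateTag q q' r = 2) : r = q' := by
  unfold stateTag at h; split_ifs at h <;> simp_all

theorem glueCode_div (q q' : Q) (g : Glue Q) : glueCode q q' g / 4 = g.1 := by
  rcases g with ⟨c, _ | r⟩
  · simp [glueCode]
  · have := stateTag_le q q' r
    simp only [glueCode, Option.elim]
    omega

theorem glueCode_glue (q q' : Q) (n : ℕ) (r : Q) (c : ℕ) :
    glueCode q q' (M.glue n r c) =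
      tagGlue n (stateTag q q' r) (stateTag q q' (M.δ r (decide (n = 12)))) c := by
  unfold Machine.glue tagGlue
  split_ifs <;> simp [glueCode]

theorem tileSides_tile (q q' : Q) (n : ℕ) (r : Q) :
    tileSides q q' (M.tile n r) =
      tagSides n (stateTag q q' r) (stateTag q q' (M.δ r (decide (n = 12))))
        (glueTable.getD n default) := by
  simp only [tileSides, Machine.tile, tagSides, glueCode_glue]

/-- Foreign states share tag 3, so one of the two glues has to be stateless or to carry a state of
the gadget. -/
theorem glueCode_inj {q q' : Q} {g g' : Glue Q}
    (hg : g.2 = none ∨ g.2 = some q ∨ g.2 = some q') :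
    glueCode q q' g = glueCode q q' g' ↔ g = g' := by
  refine ⟨fun h => ?_, fun h => h ▸ rfl⟩
  have h1 : g.1 = g'.1 := by rw [← glueCode_div q q' g, h, glueCode_div]
  rcases g with ⟨c, g⟩
  rcases g' with ⟨c', g'⟩
  simp only at h1 hg
  subst h1
  simp only [glueCode, Nat.add_left_cancel_iff] at h
  congr 1
  have h0 : ∀ r, 1 ≤ stateTag q q' r := fun r => by unfold stateTag; split_ifs <;> simp
  rcases hg with rfl | rfl | rfl
  · rcases g' with _ | r
    · rfl
    · have := h0 r
      simp at h
      omega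
  · rcases g' with _ | r
    · have := h0 q
      simp at h
      omega
    · simp only [Option.elim] at h
      rw [stateTag_eq_one.2 rfl] at h
      rw [stateTag_eq_one.1 h.symm]
  · rcases g' with _ | r
    · have := h0 q'
      simp at h
      omega
    · simp only [Option.elim] at h
      by_cases hq : q' = q
      · subst hq
        rw [stateTag_eq_one.2 rfl] at h
        rw [stateTag_eq_one.1 h.symm]
      · have : stateTag q q' q' = 2 := by unfold stateTag; rw [if_neg hq, if_pos rfl]
        rw [this] at h
        rw [stateTag_eq_two h.symm]

variable {M} {q : Q} {o : Bool} {u : Item}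

theorem Item.consistent_iff : u.consistent o = true ↔
    u.n < 59 ∧ (u.t = 1 ∨ u.t = 2 ∧ 13 < u.n) ∧
    u.sides = tagSides u.n u.t 2 (glueTable.getD u.n default) ∧
    (u.n = 12 → o = true) ∧ (u.n = 13 → o = false) ∧ u.x ≤ 11 := by
  unfold Item.consistent
  simp only [Bool.and_eq_true, Bool.or_eq_true, Nat.beq_eq, Nat.blt, Nat.ble_eq, decide_eq_true_eq,
    Bool.not_eq_true', Nat.succ_le_iff, ← Bool.not_eq_true, imp_iff_not_or]
  tauto

theorem tileSides_place (hu : u.consistent o = true) (k : ℕ) :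
    tileSides q (M.δ q o) (M.place q (M.δ q o) k u).tile = u.sides := by
  obtain ⟨-, h2, h3, h4, h5, -⟩ := Item.consistent_iff.1 hu
  rw [Machine.place, tileSides_tile, h3]
  have hne := M.δ_ne q o
  have t1 : stateTag q (M.δ q o) q = 1 := stateTag_eq_one.2 rfl
  have t2 : stateTag q (M.δ q o) (M.δ q o) = 2 := by
    unfold stateTag; rw [if_neg hne, if_pos rfl]
  rcases h2 with h2 | ⟨h2, h6⟩
  · rw [if_pos h2, t1, h2]
    by_cases h12 : u.n = 12
    · rw [decide_eq_true h12, ← h4 h12, t2]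
    · by_cases h13 : u.n = 13
      · rw [decide_eq_false h12, ← h5 h13, t2]
      · exact tagSides_of_ne h12 h13 _ _ _ _
  · rw [if_neg (by omega), t2, h2]
    exact tagSides_of_ne (by omega) (by omega) _ _ _ _

theorem glue_tag (hu : u.consistent o = true) (c : ℕ) :
    (M.glue u.n (if u.t = 1 then q else M.δ q o) c).2 = none ∨
    (M.glue u.n (if u.t = 1 then q else M.δ q o) c).2 = some q ∨
    (M.glue u.n (if u.t = 1 then q else M.δ q o) c).2 = some (M.δ q o) := by
  obtain ⟨-, h2, -, h4, h5, -⟩ := Item.consistent_iff.1 hu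
  unfold Machine.glue
  split_ifs with h6 h7 h8 h9
  · simp
  · right; right
    rcases h7.2 with h | h
    · simp [h, h4 h]
    · simp [h, h5 h]
  · omega
  · simp
  · simp

/-- The tile `b` is arbitrary, but the glues of the placed item satisfy the hypothesis of
`glueCode_inj`, so comparing codes is faithful. -/
theorem bond_place (hu : u.consistent o = true) {k x y : ℕ} {b : PlacedTile (Glue Q)}
    (hb : b.pos = (((11 * k + x : ℕ) : ℤ), ((y : ℕ) : ℤ))) :
    bond glueStrength (M.place q (M.δ q o) k u) b =
      itemBond u (tileSides q (M.δ q o) b.tile) x y := by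
  have hs := tileSides_place (M := M) (q := q) hu k
  have hE := congrArg Sides.east hs
  have hW := congrArg Sides.west hs
  have hN := congrArg Sides.north hs
  have hS := congrArg Sides.south hs
  have kE := fun g => glueCode_inj (g' := g) (glue_tag (M := M) (q := q) hu
    (glueTable.getD u.n default).east)
  have kW := fun g => glueCode_inj (g' := g) (glue_tag (M := M) (q := q) hu
    (glueTable.getD u.n default).west)
  have kN := fun g => glueCode_inj (g' := g) (glue_tag (M := M) (q := q) hu
    (glueTable.getD u.n default).north)
  have kS := fun g => glueCode_inj (g' := g) (glue_tag (M := M) (q := q) hu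
    (glueTable.getD u.n default).south)
  have hstr : ∀ g : Glue Q, codeStrength (glueCode q (M.δ q o) g / 4) = glueStrength g :=
    fun g => by rw [glueCode_div]; rfl
  simp only [tileSides, Machine.place, Machine.tile] at hE hW hN hS
  unfold bond itemBond
  simp only [hb, Machine.place, Prod.mk_add_mk, Prod.mk.injEq, tileSides, Nat.beq_eq, hstr,
    Machine.tile, ← hE, ← hW, ← hN, ← hS, kE, kW, kN, kS]
  clear hs hE hW hN hS kE kW kN kS
  generalize M.glue u.n _ _ = gE
  generalize M.glue u.n _ _ = gW
  generalize M.glue u.n _ _ = gN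
  generalize M.glue u.n _ _ = gS
  have e1 : ((11 * k + x : ℕ) : ℤ) = ((11 * k + u.x : ℕ) : ℤ) + 1 ↔ u.x + 1 = x := by omega
  have e2 : ((11 * k + x : ℕ) : ℤ) = ((11 * k + u.x : ℕ) : ℤ) + -1 ↔ u.x = x + 1 := by omega
  have e3 : ((11 * k + x : ℕ) : ℤ) = ((11 * k + u.x : ℕ) : ℤ) + 0 ↔ u.x = x := by omega
  have e4 : (y : ℤ) = (u.y : ℤ) + 1 ↔ u.y + 1 = y := by omega
  have e5 : (y : ℤ) = (u.y : ℤ) + -1 ↔ u.y = y + 1 := by omega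
  have e6 : (y : ℤ) = (u.y : ℤ) + 0 ↔ u.y = y := by omega
  simp only [e1, e2, e3, e4, e5, e6]
  clear e1 e2 e3 e4 e5 e6
  grind

end Tiles


/-! ### Complete gadgets and their inertness. -/

section History

variable {Q : Type} [DecidableEq Q] {M : Machine Q} {q : Q} {o : Bool} {u : Item}

theorem itemSum_eq (l : List Item) (s : Sides) (x y : ℕ) :
    itemSum l s x y = (l.map fun u => itemBond u s x y).sum := by
  induction l with
  | nil => rfl
  | cons a l ih => rw [List.map_cons, List.sum_cons, ← ih]; rfl

theorem exists_coords {l front : List Item} (hu : exposuresOk l front u = true)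
    (hc : u.consistent o = true) {k : ℕ} {b : PlacedTile (Glue Q)}
    (h : 0 < bond glueStrength (M.place q (M.δ q o) k u) b) :
    ∃ x y : ℕ, b.pos = (((11 * k + x : ℕ) : ℤ), (y : ℤ)) := by
  simp only [exposuresOk, Bool.and_eq_true, Bool.or_eq_true, Nat.blt, Nat.ble_eq] at hu
  have hs := tileSides_place (M := M) (q := q) hc k
  have four : ∀ g : Glue Q, 0 < glueStrength g → 4 ≤ glueCode q (M.δ q o) g := by
    intro g hg
    have := codeStrength_pos hg
    unfold glueCode
    omega
  rcases bond_pos h with ⟨h1, -, -⟩ | ⟨h1, -, h3⟩ | ⟨h1, -, -⟩ | ⟨h1, -, h3⟩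
  · refine ⟨u.x + 1, u.y, ?_⟩
    rw [h1]; simp only [Machine.place, Prod.mk_add_mk, Prod.mk.injEq]; omega
  · have h4 := four _ h3
    rw [show glueCode q (M.δ q o) _ = u.sides.west from congrArg Sides.west hs] at h4
    refine ⟨u.x - 1, u.y, ?_⟩
    rw [h1]; simp only [Machine.place, Prod.mk_add_mk, Prod.mk.injEq]; omega
  · refine ⟨u.x, u.y + 1, ?_⟩
    rw [h1]; simp only [Machine.place, Prod.mk_add_mk, Prod.mk.injEq]; omega
  · have h4 := four _ h3
    rw [show glueCode q (M.δ q o) _ = u.sides.south from congrArg Sides.south hs] at h4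
    refine ⟨u.x, u.y - 1, ?_⟩
    rw [h1]; simp only [Machine.place, Prod.mk_add_mk, Prod.mk.injEq]; omega

theorem sum_bond_eq {l : List Item} (hc : ∀ u ∈ l, Item.consistent o u = true) {k x y : ℕ}
    {b : PlacedTile (Glue Q)} (hb : b.pos = (((11 * k + x : ℕ) : ℤ), (y : ℤ))) :
    ((l.map (M.place q (M.δ q o) k)).map fun a => bond glueStrength a b).sum =
      itemSum l (tileSides q (M.δ q o) b.tile) x y := by
  rw [itemSum_eq, List.map_map]
  congr 1
  exact List.map_congr_left fun u hu => bond_place (hc u hu) hb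

/-- Only items of `front` can attach to the tiles of `l`. -/
theorem sum_bond_le {l front : List Item} (hl : ∀ u ∈ l, exposuresOk l front u = true)
    (hc : ∀ u ∈ l, Item.consistent o u = true) {k n : ℕ} {r : Q} {z : ℤ × ℤ} (hn : n < 59)
    (hocc : ∀ u ∈ l, (M.place q (M.δ q o) k u).pos ≠ z) :
    ((l.map (M.place q (M.δ q o) k)).map fun a => bond glueStrength a ⟨M.tile n r, z⟩).sum = 0 ∨
    11 * k + 1 ≤ z.1 ∧
      (((l.map (M.place q (M.δ q o) k)).map fun a => bond glueStrength a ⟨M.tile n r, z⟩).sum ≤ 1 ∨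
      ∃ f ∈ front, f.n = n ∧ (n < 11 ∨ f.t = stateTag q (M.δ q o) r) ∧
        z = (((11 * k + f.x : ℕ) : ℤ), (f.y : ℤ))) := by
  by_cases h0 : ∀ u ∈ l, bond glueStrength (M.place q (M.δ q o) k u) ⟨M.tile n r, z⟩ = 0
  · left
    apply List.sum_eq_zero
    simpa using h0
  · right
    push Not at h0
    obtain ⟨u, hu, hne⟩ := h0
    obtain ⟨x, y, hz⟩ := exists_coords (hl u hu) (hc u hu) (Nat.pos_of_ne_zero hne)
    simp only at hz
    subst hz
    rw [sum_bond_eq hc rfl]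
    have hpos := Nat.pos_of_ne_zero hne
    rw [bond_place (hc u hu) rfl] at hpos
    simp only [tileSides_tile] at hpos ⊢
    obtain ⟨h1, h2⟩ := le_one_or_front hl hn (stateTag_mem _ _ _) (stateTag_mem _ _ _) (by
      intro v hv hxy
      apply hocc v hv
      simp [Machine.place, hxy.1, hxy.2]) hu hpos
    refine ⟨by push_cast; omega, h2.imp_right ?_⟩
    rintro ⟨f, hf, h3, h4, rfl, rfl⟩
    exact ⟨f, hf, h3, h4, rfl⟩

variable (M)

/-- The state of the machine after the outcomes `h`, the latest one first. -/
def Machine.run : List Bool → Q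
  | [] => M.start
  | o :: h => M.δ (Machine.run h) o

/-- The tiles of the complete gadgets with outcomes `h`. -/
def Machine.oldTiles : List Bool → List (PlacedTile (Glue Q))
  | [] => [M.place M.start M.start 0 entryItem]
  | o :: h => Machine.oldTiles h ++ (fullItems o).map (M.place (M.run h) (M.run (o :: h)) h.length)

/-- The tile at the entry of the gadget after the outcomes `h`, without irrelevant glues. -/
def Machine.entry (h : List Bool) : PlacedTile (Glue Q) :=
  M.place (M.run h) (M.run (true :: h)) h.length entryItem

variable {M}

theorem place_of_tag {u : Item} (hu : u.t = 1) (q q' q'' : Q) (k : ℕ) :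
    M.place q q' k u = M.place q q'' k u := by
  simp [Machine.place, hu]

theorem entry_pos (h : List Bool) : (M.entry h).pos = (((11 * h.length : ℕ) : ℤ), 6) := rfl

/-- The last tile of a complete gadget plays the part of the seed for the next one: it has the same
position and east glue as the ideal entry tile. -/
theorem exists_entry (h : List Bool) : ∃ a ∈ M.oldTiles h, a.pos = (M.entry h).pos ∧
    a.tile.east = (M.entry h).tile.east := by
  cases h with
  | nil => exact ⟨_, List.mem_singleton_self _, rfl, rfl⟩
  | cons o h =>
    refine ⟨M.place (M.run h) (M.run (o :: h)) h.length lastItem, ?_, ?_, rfl⟩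
    · apply List.mem_append_right
      apply List.mem_map_of_mem
      rw [(fullItems_eq o).1]
      simp
    · simp only [entry_pos, Machine.place, List.length_cons, lastItem]
      norm_num
      ring

theorem oldTiles_pos (h : List Bool) : ∀ a ∈ M.oldTiles h, a.pos.1 ≤ 11 * h.length := by
  induction h with
  | nil => intro a ha; rw [Machine.oldTiles, List.mem_singleton] at ha; subst ha; simp [Machine.place, entryItem]
  | cons o h ih =>
    intro a ha
    rw [Machine.oldTiles, List.mem_append] at ha
    rcases ha with ha | ha
    · have := ih a ha
      push_cast [List.length_cons]
      omega
    · obtain ⟨u, hu, rfl⟩ := List.mem_map.1 ha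
      have := (Item.consistent_iff.1 (List.all_eq_true.1 (consistent_fullItems o) u
        (List.mem_cons_of_mem _ hu))).2.2.2.2.2
      simp only [Machine.place, List.length_cons]
      push_cast
      omega

theorem place_pos_inj {q q' : Q} {k : ℕ} {u v : Item}
    (h : (M.place q q' k u).pos = (M.place q q' k v).pos) : (u.x, u.y) = (v.x, v.y) := by
  simp only [Machine.place, Prod.mk.injEq] at h ⊢
  omega

theorem nodup_pos_map {l : List Item} (hl : (l.map fun u => (u.x, u.y)).Nodup) (q q' : Q) (k : ℕ) :
    ((l.map (M.place q q' k)).map PlacedTile.pos).Nodup := by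
  rw [List.map_map]
  rw [List.Nodup, List.pairwise_map] at hl ⊢
  exact hl.imp fun hab he => hab (place_pos_inj he)

theorem nodup_pos_append {h : List Bool} {l : List Item} (hold : ((M.oldTiles h).map PlacedTile.pos).Nodup)
    (hl : (l.map fun u => (u.x, u.y)).Nodup) (hx : ∀ u ∈ l, 1 ≤ u.x) (q q' : Q) :
    ((M.oldTiles h ++ l.map (M.place q q' h.length)).map PlacedTile.pos).Nodup := by
  rw [List.map_append, List.nodup_append]
  refine ⟨hold, nodup_pos_map hl _ _ _, ?_⟩
  intro p hp p' hp' he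
  subst he
  obtain ⟨a, ha, rfl⟩ := List.mem_map.1 hp
  obtain ⟨b, hb, he⟩ := List.mem_map.1 hp'
  obtain ⟨u, hu, rfl⟩ := List.mem_map.1 hb
  have h1 := oldTiles_pos h a ha
  have h2 := hx u hu
  have h3 := congrArg Prod.fst he
  simp only [Machine.place] at h3
  push_cast at h3
  omega

theorem nodup_oldTiles (h : List Bool) : ((M.oldTiles h).map PlacedTile.pos).Nodup := by
  induction h with
  | nil => simp [Machine.oldTiles]
  | cons o h ih =>
    exact nodup_pos_append ih (List.nodup_cons.1 (nodup_fullItems o)).2 (one_le_fullItems o) _ _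

theorem entry_eq (o : Bool) (h : List Bool) :
    M.entry h = M.place (M.run h) (M.δ (M.run h) o) h.length entryItem :=
  place_of_tag rfl _ _ _ _

/-- The complete gadgets are inert, except for the exit of the last one. -/
theorem oldTiles_inert (h : List Bool) {n : ℕ} (hn : n < 59) (r : Q) (z : ℤ × ℤ)
    (hz : ∀ a ∈ M.oldTiles h, a.pos ≠ z) :
    (z.1 ≤ 11 * h.length →
      ((M.oldTiles h).map fun a => bond glueStrength a ⟨M.tile n r, z⟩).sum ≤ 1) ∧
    (11 * h.length < z.1 →
      ((M.oldTiles h).map fun a => bond glueStrength a ⟨M.tile n r, z⟩).sum ≤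
        bond glueStrength (M.entry h) ⟨M.tile n r, z⟩) := by
  induction h with
  | nil =>
    simp only [Machine.oldTiles, List.map_cons, List.map_nil, List.sum_cons, List.sum_nil, add_zero,
      List.length_nil, Nat.cast_zero, mul_zero]
    have he : M.place M.start M.start 0 entryItem = M.entry [] := place_of_tag rfl _ _ _ _
    rw [he]
    refine ⟨fun hx => ?_, fun _ => le_rfl⟩
    by_contra hlt
    have hpos : 0 < bond glueStrength (M.entry []) ⟨M.tile n r, z⟩ := by omega
    rcases bond_pos hpos with h | h | h | h
    · have := congrArg Prod.fst h.1
      rw [entry_pos] at this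
      simp only [List.length_nil, Prod.fst_add] at this
      omega
    all_goals
      exact absurd h.2.2 (lt_irrefl 0)
  | cons o h ih =>
    have ih := ih fun a ha => hz a (List.mem_append_left _ ha)
    simp only [Machine.oldTiles, List.map_append, List.sum_append, List.length_cons]
    have hocc : ∀ u ∈ entryItem :: fullItems o,
        (M.place (M.run h) (M.δ (M.run h) o) h.length u).pos ≠ z := by
      intro u hu
      rcases List.mem_cons.1 hu with rfl | hu
      · obtain ⟨a, ha, hpos, -⟩ := exists_entry (M := M) h
        rw [← entry_eq, ← hpos]
        exact hz a (List.mem_append_left _ ha)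
      · exact hz (M.place (M.run h) (M.δ (M.run h) o) h.length u)
          (List.mem_append_right _ (List.mem_map_of_mem hu))
    have hloc := sum_bond_le (r := r) (List.all_eq_true.1 (exposuresOk_fullItems o))
      (List.all_eq_true.1 (consistent_fullItems o)) hn hocc
    rw [List.map_cons, List.map_cons, List.sum_cons, ← entry_eq] at hloc
    simp only [Machine.run]
    generalize hB : bond glueStrength (M.entry h) ⟨M.tile n r, z⟩ = B at *
    generalize hF : (List.map (fun a => bond glueStrength a ⟨M.tile n r, z⟩)
      (List.map (M.place (M.run h) (M.δ (M.run h) o) h.length) (fullItems o))).sum = F at *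
    generalize (List.map (fun a => bond glueStrength a ⟨M.tile n r, z⟩) (M.oldTiles h)).sum = O at *
    push_cast
    constructor
    · intro hx
      -- The exit item lies in column 12, beyond the boundary considered here.
      have hloc' : B + F = 0 ∨ 11 * (h.length : ℤ) + 1 ≤ z.1 ∧ B + F ≤ 1 := by
        rcases hloc with h0 | ⟨h1, h2 | ⟨f, hf, -, -, h3⟩⟩
        · exact Or.inl h0
        · exact Or.inr ⟨h1, h2⟩
        · rw [List.mem_singleton] at hf
          subst hf
          have := congrArg Prod.fst h3
          simp only [exitItem] at this
          push_cast at this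
          omega
      -- West of the gadget `F` vanishes; inside it, the older tiles act at most through the entry
      -- tile, whose bond `B` is already counted.
      by_cases hx' : z.1 ≤ 11 * (h.length : ℤ)
      · have := ih.1 hx'
        omega
      · have := ih.2 (by omega)
        omega
    · intro hx
      -- Beyond the new boundary the older gadgets are out of reach.
      have hO : O = 0 := by
        have h1 := ih.2 (by omega)
        rw [bond_eq_zero_of_lt] at hB
        · omega
        · rw [entry_pos]; push_cast; omega
        · left; rw [entry_pos]; push_cast; omega
      have hF' : F = bond glueStrength (M.place (M.run h) (M.δ (M.run h) o) h.length lastItem)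
          ⟨M.tile n r, z⟩ := by
        rw [← hF, (fullItems_eq o).1]
        simp only [List.map_append, List.sum_append, List.map_cons, List.map_nil, List.sum_cons,
          List.sum_nil, add_zero]
        rw [Nat.add_eq_right]
        apply List.sum_eq_zero
        intro x hx'
        simp only [List.mem_map] at hx'
        obtain ⟨-, ⟨u, hu, rfl⟩, rfl⟩ := hx'
        have hc := List.all_eq_true.1 (consistent_fullItems o) u
          (List.mem_cons_of_mem _ (List.mem_of_mem_dropLast hu))
        have hux := (Item.consistent_iff.1 hc).2.2.2.2.2
        apply bond_eq_zero_of_lt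
        · simp only [Machine.place]; push_cast; omega
        · rcases (fullItems_eq o).2 u hu with h1 | h1
          · left; simp only [Machine.place]; push_cast; omega
          · right
            have := congrArg Sides.east (tileSides_place (M := M) (q := M.run h) hc h.length)
            rw [h1] at this
            have h2 : glueCode (M.run h) (M.δ (M.run h) o) (M.place (M.run h) (M.δ (M.run h) o)
              h.length u).tile.east = 0 := this
            have h3 := glueCode_div (M.run h) (M.δ (M.run h) o) (M.place (M.run h) (M.δ (M.run h) o)
              h.length u).tile.east
            rw [h2] at h3
            rw [glueStrength, ← h3]; rfl
      rw [hO, zero_add, hF']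
      apply bond_le_of_east
      · simp only [entry_pos, Machine.place, List.length_cons, lastItem]
        norm_num
        ring
      · rfl
      · simp only [Machine.place, lastItem]; push_cast; omega

end History


/-! ### Growth within a gadget, tile by tile. -/

section Progress

theorem mem_take_succ {E : Type} {l : List E} {k : ℕ} (hk : k < l.length) (d u : E) :
    u ∈ l.take (k + 1) ↔ u = l.getD k d ∨ u ∈ l.take k := by
  rw [← List.take_append_getElem hk, List.getD_eq_getElem _ _ hk, List.mem_append,
    List.mem_singleton, or_comm]

theorem Progress.items_sublist (σ : Progress) : σ.items.Sublist (fullItems σ.o) :=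
  (((List.take_sublist _ _).append (List.take_sublist _ _)).append (List.take_sublist _ _)).append
    (List.take_sublist _ _)

theorem mem_items_next {σ : Progress} {e : Item × Progress} (he : e ∈ σ.next) (u : Item) :
    u ∈ e.2.items ↔ u = e.1 ∨ u ∈ σ.items := by
  have hp := fun h => mem_take_succ (l := frameItems) (k := σ.p) h default u
  have hi := fun h => mem_take_succ (l := leftItems) (k := σ.i) h default u
  have hj := fun h => mem_take_succ (l := rightItems) (k := σ.j) h default u
  have hm := fun h => mem_take_succ (l := claimItems σ.o) (k := σ.m) h default u
  have lp : frameItems.length = 38 := rfl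
  have li : leftItems.length = 6 := rfl
  have lj : rightItems.length = 6 := rfl
  have lm : ∀ b, 2 < (claimItems b).length := by decide
  have lm0 := fun b => (lm b).trans' (show 0 < 2 by omega)
  have h0 : ∀ b, u ∈ (claimItems b).take 1 ↔ u = (claimItems b).getD 0 default := fun b => by
    rw [mem_take_succ (lm0 b) default, List.take_zero]; simp only [List.not_mem_nil, or_false]
  have left : ∀ e, e = σ.leftNext → (σ.m = 0 ∨ σ.i < 6) →
      (u ∈ e.2.items ↔ u = e.1 ∨ u ∈ σ.items) := by
    rintro e rfl h
    unfold Progress.leftNext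
    split_ifs with h6
    · simp only [Progress.items, List.mem_append, hi (li ▸ h6)]
      clear * -
      tauto
    · have hm0 : σ.m = 0 := by omega
      simp only [Progress.items, List.mem_append, hm0, List.take_zero, List.not_mem_nil, or_false,
        h0]
      clear * -
      tauto
  have right : ∀ e, e = σ.rightNext → (σ.m = 0 ∨ σ.j < 6) →
      (u ∈ e.2.items ↔ u = e.1 ∨ u ∈ σ.items) := by
    rintro e rfl h
    unfold Progress.rightNext
    split_ifs with h6
    · simp only [Progress.items, List.mem_append, hj (lj ▸ h6)]
      clear * -
      tauto
    · have hm0 : σ.m = 0 := by omega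
      simp only [Progress.items, List.mem_append, hm0, List.take_zero, List.not_mem_nil, or_false,
        h0]
      clear * -
      tauto
  have report : σ.m = 1 → ∀ e, e = ((claimItems σ.o).getD 1 default, { σ with m := 2 }) →
      (u ∈ e.2.items ↔ u = e.1 ∨ u ∈ σ.items) := by
    rintro h1 e rfl
    rw [h1] at hm
    simp only [Progress.items, List.mem_append, h1, hm ((lm _).trans' (by omega))]
    clear * -
    tauto
  unfold Progress.next at he
  split_ifs at he with h1 h2 h3 h4 h5 h6 h7
  · rw [List.mem_singleton] at he
    subst he
    simp only [Progress.items, List.mem_append, hp (lp ▸ h1)]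
    clear * -
    tauto
  · simp only [List.mem_cons, List.not_mem_nil, or_false] at he
    rcases he with he | he
    · exact left _ he (Or.inl h2)
    · exact right _ he (Or.inl h2)
  · simp only [List.mem_cons, List.not_mem_nil, or_false] at he
    rcases he with he | he
    · exact report h4 _ he
    · exact left _ he (Or.inr h3)
  · rw [List.mem_singleton] at he
    exact left _ he (Or.inr h3)
  · simp only [List.mem_cons, List.not_mem_nil, or_false] at he
    rcases he with he | he
    · exact report h6 _ he
    · exact right _ he (Or.inr h5)
  · rw [List.mem_singleton] at he
    exact right _ he (Or.inr h5)
  · rw [List.mem_singleton] at he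
    subst he
    simp only [Progress.items, List.mem_append, hm h7]
    clear * -
    tauto
  · simp at he

/-- While the outcome is undecided, no placed tile depends on the next state, so the default outcome
does no harm. -/
theorem tag_items_of_m_eq_zero {σ : Progress} (h : σ.m = 0) : ∀ u ∈ σ.items, u.t = 1 := by
  have h1 : ∀ u ∈ frameItems ++ leftItems ++ rightItems, u.t = 1 := by decide
  intro u hu
  apply h1
  simp only [Progress.items, h, List.take_zero, List.append_nil] at hu
  exact (((List.take_sublist _ _).append (List.take_sublist _ _)).append
    (List.take_sublist _ _)).subset hu

theorem lt_length_of_mem : ∀ σ ∈ progressStates, σ.m < (claimItems σ.o).length := by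
  decide +kernel

theorem kind_next : ∀ σ ∈ progressStates, ∀ e ∈ σ.next, e.1.n ≠ 11 := by
  decide +kernel

/-- The progress at the beginning of a gadget. -/
def Progress.zero : Progress := ⟨0, 0, 0, true, 0⟩

theorem zero_mem : Progress.zero ∈ progressStates := by decide +kernel

/-- A tile of the next state is always the only candidate; if the types for that state are missing,
all growth stops. -/
theorem length_next_of_tag : ∀ σ ∈ progressStates, ∀ e ∈ σ.next, e.1.t = 2 →
    σ.next.length = 1 := by
  decide +kernel

theorem length_next_le : ∀ σ ∈ progressStates, σ.next.length ≤ 2 := by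
  decide +kernel

end Progress

/-! ### The tile system of a machine and its representation by states. -/

section System

variable {Q : Type} [DecidableEq Q] (M : Machine Q)

/-- The outcomes of the complete gadgets, the latest one first, and the progress of the current
gadget. -/
abbrev State := List Bool × Progress

def Machine.tiles (s : State) : List (PlacedTile (Glue Q)) :=
  M.oldTiles s.1 ++ s.2.items.map (M.place (M.run s.1) (M.run (s.2.o :: s.1)) s.1.length)

theorem Machine.nodup_pos (s : State) : ((M.tiles s).map PlacedTile.pos).Nodup := by
  refine nodup_pos_append (nodup_oldTiles _) ?_ (fun u hu => ?_) _ _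
  · exact (List.nodup_cons.1 (nodup_fullItems s.2.o)).2.sublist (s.2.items_sublist.map _)
  · exact one_le_fullItems _ u (s.2.items_sublist.subset hu)

open Classical in
/-- The assembly in the state `s`. -/
noncomputable def Machine.assembly (s : State) : Assembly (Glue Q) where
  tiles := (M.tiles s).toFinset
  pos_unique _ ha _ hb h :=
    List.inj_on_of_nodup_map (M.nodup_pos s) (List.mem_toFinset.1 ha) (List.mem_toFinset.1 hb) h

theorem Machine.mem_assembly {s : State} {a : PlacedTile (Glue Q)} :
    a ∈ (M.assembly s).tiles ↔ a ∈ M.tiles s := by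
  simp [Machine.assembly]

open Classical in
-- Kinds 0 to 10 are stateless and the seed occurs only in the start state. The other 47 kinds exist
-- for running states only, which is how a halt ends the growth.
noncomputable def Machine.tileSet : Finset (Tile (Glue Q)) :=
  (Finset.range 12).image (fun n => M.tile n M.start) ∪
    (Finset.Ico 12 59 ×ˢ M.states).image fun p => M.tile p.1 p.2

theorem Machine.card_tileSet_le : M.tileSet.card ≤ 12 + 47 * M.states.card := by
  classical
  refine (Finset.card_union_le _ _).trans (Nat.add_le_add ?_ ?_)
  · exact Finset.card_image_le.trans (by simp)
  · refine Finset.card_image_le.trans ?_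
    rw [Finset.card_product]
    simp

theorem Machine.tile_mem_of_le {n : ℕ} (h : 12 ≤ n) (hn : n < 59) {r : Q} (hr : r ∈ M.states) :
    M.tile n r ∈ M.tileSet := by
  classical
  refine Finset.mem_union_right _ (Finset.mem_image.2 ⟨(n, r), ?_, rfl⟩)
  simp [h, hn, hr]

theorem Machine.tile_start_mem {n : ℕ} (h : n < 12) : M.tile n M.start ∈ M.tileSet := by
  classical
  exact Finset.mem_union_left _ (Finset.mem_image.2 ⟨n, by simpa using h, rfl⟩)

theorem Machine.tile_eq_of_lt {n : ℕ} (h : n < 11) (r r' : Q) : M.tile n r = M.tile n r' := by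
  obtain ⟨h1, h2, h3, h4⟩ := untagged n h
  simp only [Machine.tile, Machine.glue, h1, h2, h3, h4, if_true]

theorem Machine.exists_of_mem_tileSet {t : Tile (Glue Q)} (ht : t ∈ M.tileSet) :
    ∃ n r, n < 59 ∧ r ∈ M.states ∧ t = M.tile n r := by
  classical
  rcases Finset.mem_union.1 ht with h | h
  · obtain ⟨n, hn, rfl⟩ := Finset.mem_image.1 h
    rw [Finset.mem_range] at hn
    exact ⟨n, _, by omega, M.start_mem, rfl⟩
  · obtain ⟨⟨n, r⟩, hn, rfl⟩ := Finset.mem_image.1 h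
    simp only [Finset.mem_product, Finset.mem_Ico] at hn
    exact ⟨n, r, hn.1.2, hn.2, rfl⟩

/-- The tile system that simulates the machine on random bits. -/
noncomputable def Machine.system : TileSystem (Glue Q) where
  strength := glueStrength
  tileSet := M.tileSet
  seed := M.assembly ([], Progress.zero)
  seed_mem a ha := by
    rw [M.mem_assembly] at ha
    have : a = M.place M.start M.start 0 entryItem := by
      simpa [Machine.tiles, Progress.items, Progress.zero, Machine.oldTiles] using ha
    subst this
    exact M.tile_start_mem (by decide)
  temperature := 2
  temperature_pos := two_pos

/-- The state `s` leads to a halt of the machine. -/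
def Machine.Halted (s : State) : Prop :=
  M.run (s.2.o :: s.1) ∉ M.states ∧ ∃ e ∈ s.2.next, e.1.t = 2

/-- Begin a new gadget if the current one is complete. -/
def advance (h : List Bool) (σ : Progress) : State :=
  if σ.m = (claimItems σ.o).length then (σ.o :: h, Progress.zero) else (h, σ)

open Classical in
/-- The possible attachments in the state `s`. -/
noncomputable def Machine.next (s : State) : List (PlacedTile (Glue Q) × State) :=
  if M.Halted s then []
  else s.2.next.map fun e =>
    (M.place (M.run s.1) (M.run (s.2.o :: s.1)) s.1.length e.1, advance s.1 e.2)

/-- The states that occur. -/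
structure Machine.Valid (s : State) : Prop where
  progress : s.2 ∈ progressStates
  running : ∀ h, h <:+ s.1 → M.run h ∈ M.states
  stable : (M.assembly s).Stable glueStrength 2

variable {M}

theorem Machine.advance_of_mem {σ : Progress} (h : List Bool) (hσ : σ ∈ progressStates) :
    advance h σ = (h, σ) :=
  if_neg (lt_length_of_mem σ hσ).ne

/-- `advance` only changes the bookkeeping: the tiles of a completed gadget move into `oldTiles`. -/
theorem Machine.mem_tiles_next {s : State} (hs : s.2 ∈ progressStates) {e : Item × Progress}
    (he : e ∈ s.2.next) (a : PlacedTile (Glue Q)) : a ∈ M.tiles (advance s.1 e.2) ↔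
      a = M.place (M.run s.1) (M.run (s.2.o :: s.1)) s.1.length e.1 ∨ a ∈ M.tiles s := by
  have h1 : a ∈ M.tiles (s.1, e.2) ↔
      a = M.place (M.run s.1) (M.run (s.2.o :: s.1)) s.1.length e.1 ∨ a ∈ M.tiles s := by
    have hpl : M.place (M.run s.1) (M.run (e.2.o :: s.1)) s.1.length e.1 =
          M.place (M.run s.1) (M.run (s.2.o :: s.1)) s.1.length e.1 ∧
        ∀ u ∈ s.2.items, M.place (M.run s.1) (M.run (e.2.o :: s.1)) s.1.length u =
          M.place (M.run s.1) (M.run (s.2.o :: s.1)) s.1.length u := by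
      rcases (consistent_next _ hs e he).2.2 with h | ⟨h, h'⟩
      · rw [h]; simp
      · exact ⟨place_of_tag h' _ _ _ _, fun u hu =>
          place_of_tag (tag_items_of_m_eq_zero h u hu) _ _ _ _⟩
    simp only [Machine.tiles, List.mem_append, List.mem_map, mem_items_next he]
    constructor
    · rintro (h | ⟨u, rfl | hu, rfl⟩)
      · exact Or.inr (Or.inl h)
      · exact Or.inl hpl.1
      · exact Or.inr (Or.inr ⟨u, hu, (hpl.2 u hu).symm⟩)
    · rintro (rfl | h | ⟨u, hu, rfl⟩)
      · exact Or.inr ⟨_, Or.inl rfl, hpl.1⟩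
      · exact Or.inl h
      · exact Or.inr ⟨u, Or.inr hu, hpl.2 u hu⟩
  rw [← h1]
  rcases next_mem _ hs e he with h | ⟨h, -⟩
  · rw [Machine.advance_of_mem _ h]
  · have hitems : e.2.items = fullItems e.2.o := by
      rw [h]
      simp only [Progress.items, fullItems]
      cases s.2.o <;> rfl
    have hadv : advance s.1 e.2 = (e.2.o :: s.1, Progress.zero) := if_pos (by rw [h])
    have hz : Progress.zero.items = [] := rfl
    rw [hadv]
    simp only [Machine.tiles, Machine.oldTiles, hitems, hz, List.map_nil, List.append_nil]

theorem Machine.mem_next {s : State} {e : PlacedTile (Glue Q) × State} : e ∈ M.next s ↔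
    ¬ M.Halted s ∧ ∃ f ∈ s.2.next,
      (M.place (M.run s.1) (M.run (s.2.o :: s.1)) s.1.length f.1, advance s.1 f.2) = e := by
  unfold Machine.next
  split_ifs with h
  · simp [h]
  · simp [h]

theorem Machine.sum_assembly (s : State) (b : PlacedTile (Glue Q)) :
    ∑ a ∈ (M.assembly s).tiles, bond glueStrength a b =
      ((M.oldTiles s.1).map fun a => bond glueStrength a b).sum +
      ((s.2.items.map (M.place (M.run s.1) (M.run (s.2.o :: s.1)) s.1.length)).map
        fun a => bond glueStrength a b).sum := by
  classical
  have : (M.assembly s).tiles = (M.tiles s).toFinset := by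
    unfold Machine.assembly
    congr
  rw [this, List.sum_toFinset _ (List.Nodup.of_map _ (M.nodup_pos s)), Machine.tiles, List.map_append, List.sum_append]

theorem Machine.Valid.attaches {s : State} (hs : M.Valid s) {e : PlacedTile (Glue Q) × State}
    (he : e ∈ M.next s) : M.system.Attaches (M.assembly s) e.1 (M.assembly e.2) := by
  classical
  obtain ⟨hh, f, hf, rfl⟩ := Machine.mem_next.1 he
  obtain ⟨hcons, hx, -⟩ := consistent_next _ hs.progress f hf
  have hq : M.run s.1 ∈ M.states := hs.running _ (List.suffix_refl _)
  have hci := Item.consistent_iff.1 hcons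
  have hmemT : (M.place (M.run s.1) (M.run (s.2.o :: s.1)) s.1.length f.1).tile ∈ M.tileSet := by
    have h11 := kind_next _ hs.progress f hf
    simp only [Machine.place]
    rcases hci.2.1 with ht | ⟨ht, h13⟩
    · rw [if_pos ht]
      by_cases h12 : f.1.n < 11
      · rw [M.tile_eq_of_lt h12 _ M.start]
        exact M.tile_start_mem (by omega)
      · exact M.tile_mem_of_le (by omega) hci.1 hq
    · rw [if_neg (by omega)]
      refine M.tile_mem_of_le (by omega) hci.1 ?_
      by_contra hns
      exact hh ⟨hns, f, hf, ht⟩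
  have hcheck := List.all_eq_true.1 check_progressStates _ hs.progress
  simp only [Progress.check, Bool.and_eq_true, List.all_eq_true, Bool.not_eq_true',
    Nat.ble_eq] at hcheck
  have hfc := hcheck.2 f.1 (List.mem_map_of_mem hf)
  have hnotpos : ∀ a ∈ M.tiles s,
      a.pos ≠ (M.place (M.run s.1) (M.run (s.2.o :: s.1)) s.1.length f.1).pos := by
    intro a ha hpos
    rcases List.mem_append.1 ha with ha | ha
    · have h1 := oldTiles_pos _ a ha
      rw [hpos] at h1
      simp only [Machine.place] at h1
      push_cast at h1
      omega
    · obtain ⟨u, hu, rfl⟩ := List.mem_map.1 ha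
      have h1 := place_pos_inj hpos
      simp only [Prod.mk.injEq] at h1
      rw [isOcc_iff.2 ⟨u, List.mem_cons_of_mem _ hu, h1⟩] at hfc
      exact absurd hfc.1 (by decide)
  have hnot : M.place (M.run s.1) (M.run (s.2.o :: s.1)) s.1.length f.1 ∉ (M.assembly s).tiles := by
    rw [M.mem_assembly]
    exact fun h => hnotpos _ h rfl
  have htiles : (M.assembly (advance s.1 f.2)).tiles =
      insert (M.place (M.run s.1) (M.run (s.2.o :: s.1)) s.1.length f.1) (M.assembly s).tiles := by
    ext a
    rw [Finset.mem_insert, M.mem_assembly, M.mem_assembly]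
    exact Machine.mem_tiles_next hs.progress hf a
  refine ⟨hmemT, hnot, htiles, ?_⟩
  refine Assembly.Stable.of_bond hs.stable hnot htiles ?_
  change 2 ≤ ∑ a ∈ (M.assembly s).tiles, bond glueStrength a _
  rw [Machine.sum_assembly]
  set b := M.place (M.run s.1) (M.run (s.2.o :: s.1)) s.1.length f.1 with hb
  have hcl : ∀ u ∈ entryItem :: s.2.items, Item.consistent s.2.o u = true := fun u hu =>
    List.all_eq_true.1 (consistent_fullItems s.2.o) u
      ((s.2.items_sublist.cons_cons entryItem).subset hu)
  have hsum := sum_bond_eq (M := M) (q := M.run s.1) (b := b) hcl (k := s.1.length) rfl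
  rw [hb, Machine.run, tileSides_place hcons, List.map_cons, List.map_cons, List.sum_cons,
    ← entry_eq, ← Machine.run, ← hb] at hsum
  obtain ⟨a, ha, hpos, heast⟩ := exists_entry (M := M) s.1
  -- The check counted the bond with the ideal entry tile; towards the east the actual tile bonds at
  -- least as strongly.
  have h1 : bond glueStrength (M.entry s.1) b ≤ bond glueStrength a b := by
    refine bond_le_of_east hpos.symm heast.symm ?_
    rw [entry_pos, hb]
    simp only [Machine.place]
    push_cast
    omega
  have h2 : bond glueStrength a b ≤ ((M.oldTiles s.1).map fun a => bond glueStrength a b).sum :=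
    List.single_le_sum (by simp) _ (List.mem_map_of_mem ha)
  have := hfc.2
  omega

theorem Machine.Valid.next {s : State} (hs : M.Valid s) {e : PlacedTile (Glue Q) × State}
    (he : e ∈ M.next s) : M.Valid e.2 := by
  have hst := (hs.attaches he).2.2.2
  obtain ⟨hh, f, hf, rfl⟩ := Machine.mem_next.1 he
  rcases next_mem _ hs.progress f hf with h | ⟨h, ht⟩
  · rw [Machine.advance_of_mem _ h] at hst ⊢
    exact ⟨h, hs.running, hst⟩
  · have hadv : advance s.1 f.2 = (s.2.o :: s.1, Progress.zero) := by
      rw [advance, if_pos (by rw [h]), h]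
    rw [hadv] at hst ⊢
    refine ⟨zero_mem, fun h' hh' => ?_, hst⟩
    rcases List.suffix_cons_iff.1 hh' with rfl | hh'
    · by_contra hns
      exact hh ⟨hns, f, hf, ht⟩
    · exact hs.running _ hh'

/-- West of the gadget the old tiles give at most 1 and the current ones nothing. Elsewhere the old
tiles act only through the entry tile, which the local check includes, so bond 2 forces a listed
item. -/
theorem Machine.Valid.frontier {s : State} (hs : M.Valid s) {b : PlacedTile (Glue Q)}
    (hb : b ∈ M.system.frontier (M.assembly s)) : ∃ t, (b, t) ∈ M.next s := by
  classical
  obtain ⟨B, hbT, hbn, hB, hstab⟩ := hb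
  obtain ⟨n, r, hn, hr, htile⟩ := M.exists_of_mem_tileSet hbT
  obtain ⟨t, z⟩ := b
  simp only at htile
  subst htile
  have hocc : ∀ a ∈ M.tiles s, a.pos ≠ z := by
    intro a ha hz
    have ha' := M.mem_assembly.2 ha
    apply hbn
    rw [← B.pos_unique a (by rw [hB]; exact Finset.mem_insert_of_mem ha') ⟨M.tile n r, z⟩
      (by rw [hB]; exact Finset.mem_insert_self _ _) hz]
    exact ha'
  have hne : (M.assembly s).tiles.Nonempty := by
    obtain ⟨a, ha, -⟩ := exists_entry (M := M) s.1
    exact ⟨a, M.mem_assembly.2 (List.mem_append_left _ ha)⟩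
  have h2 : 2 ≤ _ := hstab.bond_le hbn hB hne
  change 2 ≤ ∑ a ∈ (M.assembly s).tiles, bond glueStrength a _ at h2
  rw [Machine.sum_assembly] at h2
  have hcl : ∀ u ∈ entryItem :: s.2.items, Item.consistent s.2.o u = true := fun u hu =>
    List.all_eq_true.1 (consistent_fullItems s.2.o) u
      ((s.2.items_sublist.cons_cons entryItem).subset hu)
  have hcheck := List.all_eq_true.1 check_progressStates _ hs.progress
  simp only [Progress.check, Bool.and_eq_true] at hcheck
  have hocc' : ∀ u ∈ entryItem :: s.2.items,
      (M.place (M.run s.1) (M.δ (M.run s.1) s.2.o) s.1.length u).pos ≠ z := by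
    intro u hu
    rcases List.mem_cons.1 hu with rfl | hu
    · obtain ⟨a, ha, hpos, -⟩ := exists_entry (M := M) s.1
      rw [← entry_eq, ← hpos]
      exact hocc a (List.mem_append_left _ ha)
    · exact hocc (M.place (M.run s.1) (M.δ (M.run s.1) s.2.o) s.1.length u)
        (List.mem_append_right _ (List.mem_map_of_mem hu))
  have hloc := sum_bond_le (r := r) (List.all_eq_true.1 hcheck.1) hcl hn hocc'
  have hold := oldTiles_inert s.1 hn r z fun a ha => hocc a (List.mem_append_left _ ha)
  rw [List.map_cons, List.map_cons, List.sum_cons, ← entry_eq] at hloc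
  rw [Machine.run] at h2
  obtain ⟨hz, f, hf, hfn, hft, hfz⟩ : 11 * (s.1.length : ℤ) + 1 ≤ z.1 ∧
      ∃ f ∈ s.2.next.map Prod.fst, f.n = n ∧
        (n < 11 ∨ f.t = stateTag (M.run s.1) (M.δ (M.run s.1) s.2.o) r) ∧
        z = (((11 * s.1.length + f.x : ℕ) : ℤ), (f.y : ℤ)) := by
    by_cases hx : z.1 ≤ 11 * (s.1.length : ℤ)
    · have h3 := hold.1 hx
      rcases hloc with h4 | ⟨h4, -⟩ <;> omega
    · have h3 := hold.2 (by omega)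
      rcases hloc with h4 | ⟨h4, h5 | h5⟩
      · omega
      · omega
      · exact ⟨h4, h5⟩
  obtain ⟨e, he, rfl⟩ := List.mem_map.1 hf
  have hcons := (consistent_next _ hs.progress e he).1
  have htile : M.tile n r = M.tile e.1.n (if e.1.t = 1 then M.run s.1 else M.δ (M.run s.1) s.2.o) ∧
      (e.1.t = 2 → M.δ (M.run s.1) s.2.o = r) := by
    obtain ⟨-, ht, -⟩ := Item.consistent_iff.1 hcons
    rcases hft with h | h
    · refine ⟨?_, fun h' => by omega⟩
      rw [hfn]
      exact M.tile_eq_of_lt h _ _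
    · rw [hfn]
      rcases ht with ht | ⟨ht, -⟩
      · rw [if_pos ht, stateTag_eq_one.1 (h.symm.trans ht)]
        exact ⟨rfl, fun h' => by omega⟩
      · rw [if_neg (by omega), stateTag_eq_two (h.symm.trans ht)]
        exact ⟨rfl, fun _ => rfl⟩
  refine ⟨advance s.1 e.2, Machine.mem_next.2 ⟨?_, e, he, ?_⟩⟩
  -- At a halt the only candidate would carry the halted state, whereas the attaching tile carries a
  -- running one.
  · rintro ⟨hns, e', he', ht'⟩
    obtain ⟨f, hf⟩ := List.length_eq_one_iff.1 (length_next_of_tag _ hs.progress e' he' ht')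
    rw [hf, List.mem_singleton] at he he'
    rw [he', ← he] at ht'
    exact hns (by rw [Machine.run, htile.2 ht']; exact hr)
  · rw [htile.1, hfz]
    rfl

theorem Machine.represents (M : Machine Q) : Represents M.system M.assembly M.next M.Valid where
  closed hs _ he := hs.next he
  attaches hs _ he := hs.attaches he
  frontier hs _ hb := hs.frontier hb
  nodup {s} hs := by
    unfold Machine.next
    split_ifs
    · simp
    · have h := nodup_next _ hs.progress
      rw [List.map_map]
      rw [List.Nodup, List.pairwise_map] at h ⊢
      refine h.imp_of_mem fun {e f} he hf hne hef => hne ?_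
      simp only [Function.comp_apply] at hef
      have h1 := place_pos_inj (congrArg PlacedTile.pos hef)
      have h2 := congrArg (fun a => (tileSides (M.run s.1) (M.run (s.2.o :: s.1)) a.tile).north) hef
      simp only [Machine.run] at h2
      rw [tileSides_place (consistent_next _ hs.progress e he).1,
        tileSides_place (consistent_next _ hs.progress f hf).1] at h2
      simp only [Prod.mk.injEq] at h1
      rw [h1.1, h1.2, h2]

end System


/-! ### The race between two arms. -/

section Race

/-- The mean of `A` and `B` with weights proportional to `c` and `d`. -/
noncomputable def mix (c d A B : ℝ≥0∞) : ℝ≥0∞ := c / (c + d) * A + d / (c + d) * B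

theorem mix_mono {A A' B B' : ℝ≥0∞} (c d : ℝ≥0∞) (hA : A ≤ A') (hB : B ≤ B') :
    mix c d A B ≤ mix c d A' B' := by
  unfold mix; gcongr

theorem mix_add (c d A A' B B' : ℝ≥0∞) :
    mix c d (A + A') (B + B') = mix c d A B + mix c d A' B' := by
  unfold mix; ring

theorem mix_comm (c d A B : ℝ≥0∞) : mix c d A B = mix d c B A := by
  unfold mix; rw [add_comm c d, add_comm]

theorem mix_self {c d : ℝ≥0∞} (hc : c ≠ 0) (hc' : c ≠ ⊤) (hd' : d ≠ ⊤) (A : ℝ≥0∞) :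
    mix c d A A = A := by
  unfold mix
  rw [← add_mul, ← ENNReal.add_div, ENNReal.div_self _ (ENNReal.add_ne_top.2 ⟨hc', hd'⟩), one_mul]
  exact fun h => hc (add_eq_zero.1 h).1

/-- The faster of two competing moves is made with probability at least one half. -/
theorem half_mul_le_mix {c d : ℝ≥0∞} (hc : c ≠ 0) (hc' : c ≠ ⊤) (hd : d ≤ c) (A B : ℝ≥0∞) :
    2⁻¹ * A ≤ mix c d A B := by
  refine le_trans ?_ le_self_add
  gcongr
  rw [ENNReal.le_div_iff_mul_le (Or.inl fun h => hc (add_eq_zero.1 h).1)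
    (Or.inl (ENNReal.add_ne_top.2 ⟨hc', ne_top_of_le_ne_top hc' hd⟩))]
  calc 2⁻¹ * (c + d) ≤ 2⁻¹ * (c + c) := by gcongr
    _ = c := by rw [← two_mul, ← mul_assoc, ENNReal.inv_mul_cancel two_ne_zero (by simp), one_mul]

/-- The expected payoff of a race in which the two contestants have `a` and `b` steps left, which
they take at the rates `l` and `r`: `x` if the first one wins, and `y` if the second one wins. -/
noncomputable def raceVal (l r : ℕ → ℝ≥0∞) (x y : ℝ≥0∞) : ℕ → ℕ → ℝ≥0∞
  | 0, _ => x
  | _ + 1, 0 => y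
  | a + 1, b + 1 => mix (l (a + 1)) (r (b + 1)) (raceVal l r x y a (b + 1)) (raceVal l r x y (a + 1) b)

variable {l r : ℕ → ℝ≥0∞}

/-- The excluded case is the tie, which `raceVal` awards to the first contestant. -/
theorem raceVal_swap (x y : ℝ≥0∞) (a b : ℕ) (h : a ≠ 0 ∨ b ≠ 0) :
    raceVal l r x y a b = raceVal r l y x b a := by
  induction a generalizing b with
  | zero =>
    cases b with
    | zero => simp at h
    | succ b => rw [raceVal, raceVal]
  | succ a iha =>
    induction b with
    | zero => rw [raceVal, raceVal]
    | succ b ihb =>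
      rw [raceVal, raceVal, iha _ (Or.inr (Nat.succ_ne_zero b)), ihb (Or.inl (Nat.succ_ne_zero a)),
        mix_comm]

theorem raceVal_linear (x y : ℝ≥0∞) (a b : ℕ) :
    raceVal l r x y a b = raceVal l r 1 0 a b * x + raceVal l r 0 1 a b * y := by
  induction a generalizing b with
  | zero => simp [raceVal]
  | succ a iha =>
    induction b with
    | zero => simp [raceVal]
    | succ b ihb =>
      rw [raceVal, iha, ihb, raceVal, raceVal]
      unfold mix
      ring

theorem raceVal_self (hl : ∀ a, l a ≠ 0 ∧ l a ≠ ⊤) (hr : ∀ b, r b ≠ 0 ∧ r b ≠ ⊤)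
    (x : ℝ≥0∞) (a b : ℕ) : raceVal l r x x a b = x := by
  induction a generalizing b with
  | zero => rw [raceVal]
  | succ a iha =>
    induction b with
    | zero => rw [raceVal]
    | succ b ihb => rw [raceVal, iha, ihb, mix_self (hl _).1 (hl _).2 (hr _).2]

theorem raceVal_ne_top (hl : ∀ a, l a ≠ 0 ∧ l a ≠ ⊤) (hr : ∀ b, r b ≠ 0 ∧ r b ≠ ⊤)
    {x y : ℝ≥0∞} (hx : x ≠ ⊤) (hy : y ≠ ⊤) (a b : ℕ) : raceVal l r x y a b ≠ ⊤ := by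
  have h : raceVal l r x y a b ≤ raceVal l r (x + y) (x + y) a b := by
    rw [raceVal_linear, raceVal_linear (x + y)]
    gcongr
    · exact le_self_add
    · exact le_add_self
  rw [raceVal_self hl hr] at h
  exact ne_top_of_le_ne_top (ENNReal.add_ne_top.2 ⟨hx, hy⟩) h

/-- If the second contestant has a slow step, then the first one may well win. -/
theorem le_raceVal (hl : ∀ a, l a ≠ 0 ∧ l a ≠ ⊤) (hr : ∀ b, r b ≠ 0 ∧ r b ≠ ⊤)
    {b₀ : ℕ} (h0 : b₀ ≠ 0) (hslow : ∀ a, r b₀ ≤ l a) (a b : ℕ) (hb : b₀ ≤ b) :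
    2⁻¹ ^ (a + (b - b₀)) ≤ raceVal l r 1 0 a b := by
  have half : (2⁻¹ : ℝ≥0∞) ≤ 1 := by simp
  induction a generalizing b with
  | zero => rw [raceVal]; exact pow_le_one₀ (by simp) half
  | succ a iha =>
    induction b, hb using Nat.le_induction with
    | base =>
      -- The second contestant now faces its slow step, so each move of the first one has
      -- probability at least 1/2.
      obtain ⟨b, rfl⟩ := Nat.exists_eq_succ_of_ne_zero h0
      rw [raceVal]
      refine le_trans ?_ (half_mul_le_mix (hl _).1 (hl _).2 (hslow _) _ _)
      rw [show a + 1 + (b.succ - b.succ) = (a + (b + 1 - b.succ)) + 1 by omega, pow_succ']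
      gcongr
      exact iha _ le_rfl
    | succ b hb ihb =>
      rw [raceVal]
      -- Before that, follow whichever move is more likely; either one lowers the exponent by 1.
      rcases le_total (r (b + 1)) (l (a + 1)) with h | h
      · refine le_trans ?_ (half_mul_le_mix (hl _).1 (hl _).2 h _ _)
        rw [show a + 1 + (b + 1 - b₀) = (a + (b + 1 - b₀)) + 1 by omega, pow_succ']
        gcongr
        exact iha _ (by omega)
      · rw [mix_comm]
        refine le_trans ?_ (half_mul_le_mix (hr _).1 (hr _).2 h _ _)
        rw [show a + 1 + (b + 1 - b₀) = (a + 1 + (b - b₀)) + 1 by omega, pow_succ']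
        gcongr

/-- The kind of the tile that is `a` steps before the end of the left arm. -/
def leftKind (a : ℕ) : ℕ := [0, 2, 4, 3, 2, 1, 1, 0].getD a 0

/-- The kind of the tile that is `b` steps before the end of the right arm. -/
def rightKind (b : ℕ) : ℕ := [0, 3, 4, 2, 3, 1, 1, 0].getD b 0

theorem kind_lt (a : ℕ) : leftKind a < 5 ∧ rightKind a < 5 := by
  rcases lt_or_ge a 8 with h | h
  · have : ∀ a < 8, leftKind a < 5 ∧ rightKind a < 5 := by decide
    exact this a h
  · simp [leftKind, rightKind, h]

/-- The race with tile concentrations `c` is not too unfair. -/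
theorem exists_race_probabilities {c : ℕ → ℝ≥0∞} (hc : ∀ k < 5, c k ≠ 0 ∧ c k ≠ ⊤) :
    ∃ α β : ℝ≥0∞, α + β = 1 ∧ 2⁻¹ ^ 12 ≤ α ∧ 2⁻¹ ^ 12 ≤ β ∧ ∀ x y,
      raceVal (fun a => c (leftKind a)) (fun b => c (rightKind b)) x y 7 7 = α * x + β * y := by
  set l : ℕ → ℝ≥0∞ := fun a => c (leftKind a)
  set r : ℕ → ℝ≥0∞ := fun b => c (rightKind b)
  have hl : ∀ a, l a ≠ 0 ∧ l a ≠ ⊤ := fun a => hc _ (kind_lt a).1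
  have hr : ∀ b, r b ≠ 0 ∧ r b ≠ ⊤ := fun b => hc _ (kind_lt b).2
  obtain ⟨k, hk, hmin⟩ := Finset.exists_min_image (Finset.range 5) c ⟨0, by simp⟩
  have hmin' : ∀ k' < 5, c k ≤ c k' := fun k' h => hmin k' (Finset.mem_range.2 h)
  have half : (2⁻¹ : ℝ≥0∞) ≤ 1 := by simp
  -- The rarest kind, like every other, occurs in both arms at least 2 steps before the end. The
  -- exponent is therefore at most 7 + (7 - 2) = 12.
  have hex : ∀ k < 5, (∃ b, 2 ≤ b ∧ b ≤ 7 ∧ rightKind b = k) ∧ ∃ a, 2 ≤ a ∧ a ≤ 7 ∧ leftKind a = k := by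
    have : ∀ k < 5, (∃ b < 8, 2 ≤ b ∧ b ≤ 7 ∧ rightKind b = k) ∧
        ∃ a < 8, 2 ≤ a ∧ a ≤ 7 ∧ leftKind a = k := by decide
    intro k hk
    obtain ⟨⟨b, -, hb⟩, ⟨a, -, ha⟩⟩ := this k hk
    exact ⟨⟨b, hb⟩, ⟨a, ha⟩⟩
  obtain ⟨⟨b, hb2, hb7, hb⟩, ⟨a, ha2, ha7, ha⟩⟩ := hex k (Finset.mem_range.1 hk)
  refine ⟨raceVal l r 1 0 7 7, raceVal l r 0 1 7 7, ?_, ?_, ?_, fun x y => raceVal_linear x y 7 7⟩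
  · have := raceVal_linear (l := l) (r := r) 1 1 7 7
    rw [raceVal_self hl hr] at this
    simpa using this.symm
  · refine le_trans (pow_le_pow_right_of_le_one' half ?_)
      (le_raceVal hl hr (b₀ := b) (by omega) (fun a => ?_) 7 7 hb7)
    · omega
    · change c (rightKind b) ≤ _
      rw [hb]
      exact hmin' _ (kind_lt a).1
  · rw [raceVal_swap _ _ _ _ (by simp)]
    refine le_trans (pow_le_pow_right_of_le_one' half ?_)
      (le_raceVal hr hl (b₀ := a) (by omega) (fun b => ?_) 7 7 ha7)
    · omega
    · change c (leftKind a) ≤ _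
      rw [ha]
      exact hmin' _ (kind_lt b).2

end Race

/-! ### A potential for the chain on states. -/

section Potential

variable {Q : Type} [DecidableEq Q] {M : Machine Q}

def Progress.count (σ : Progress) : ℕ := σ.p + σ.i + σ.j + σ.m

theorem kind_arms : ∀ σ ∈ progressStates, σ.leftNext.1.n = leftKind (7 - σ.i) ∧
    σ.rightNext.1.n = rightKind (7 - σ.j) ∧ σ.leftNext.1.n < 11 ∧ σ.rightNext.1.n < 11 := by
  decide +kernel

/-- The largest gadget has 63 = 38 + 6 + 6 + 13 tiles; a victory of the left arm needs only 11 tiles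
in the last part. -/
theorem count_next : ∀ σ ∈ progressStates, ∀ e ∈ σ.next,
    e.2.count = σ.count + 1 ∧ e.2.count ≤ 63 := by
  decide +kernel

theorem outcome_next : ∀ σ ∈ progressStates, σ.m ≠ 0 →
    ∀ e ∈ σ.next, e.2.m ≠ 0 ∧ e.2.o = σ.o := by
  decide +kernel

theorem frame_or_race : ∀ σ ∈ progressStates, σ.m = 0 →
    (∀ e ∈ σ.next, e.2.m = 0 ∧ e.2.i = σ.i ∧ e.2.j = σ.j) ∨ σ.p = 38 ∧ σ.i ≤ 6 ∧ σ.j ≤ 6 := by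
  decide +kernel

theorem next_ne_nil : ∀ σ ∈ progressStates, σ.next ≠ [] := by
  decide +kernel

theorem m_ne_zero_of_tag : ∀ σ ∈ progressStates, ∀ e ∈ σ.next, e.1.t = 2 → σ.m ≠ 0 := by
  decide +kernel

/-- The concentration of the race tiles of kind `k`. -/
noncomputable def Machine.rate (P : Concentration M.system.tileSet) (k : ℕ) : ℝ≥0∞ :=
  P.conc (M.tile k M.start)

theorem Machine.rate_ne (P : Concentration M.system.tileSet) {k : ℕ} (hk : k < 12) :
    Machine.rate P k ≠ 0 ∧ Machine.rate P k ≠ ⊤ := by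
  refine ⟨?_, ENNReal.coe_ne_top⟩
  have := P.conc_pos _ (M.tile_start_mem hk)
  exact ENNReal.coe_ne_zero.2 this.ne'

variable (P : Concentration M.system.tileSet) (κ : ℝ≥0∞) (g : List Bool → ℝ≥0∞)

/-- The expected value of `g` after the present race. -/
noncomputable def Machine.outcomeVal (h : List Bool) (σ : Progress) : ℝ≥0∞ :=
  if σ.m = 0 then
    raceVal (fun a => Machine.rate P (leftKind a)) (fun b => Machine.rate P (rightKind b))
      (g (true :: h)) (g (false :: h)) (7 - σ.i) (7 - σ.j)
  else g (σ.o :: h)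

/-- The potential of a state, where each attachment costs `κ` and `g` bounds the expected future
costs after a sequence of outcomes. -/
noncomputable def Machine.potential (h : List Bool) (σ : Progress) : ℝ≥0∞ :=
  κ * (63 - σ.count : ℕ) + Machine.outcomeVal P g h σ

theorem stepOp_le_of_forall {G S : Type} {Γ : TileSystem G} (P : Concentration Γ.tileSet)
    {next : S → List (PlacedTile G × S)} {f g : S → ℝ≥0∞} {s : S}
    (h : ∀ e ∈ next s, f e.2 ≤ g e.2) : stepOp P next f s ≤ stepOp P next g s := by
  unfold stepOp
  apply List.sum_le_sum
  intro e he
  gcongr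
  exact h e he

variable {P κ g}

theorem Machine.Valid.next_eq_nil {s : State} (hs : M.Valid s) : M.next s = [] ↔ M.Halted s := by
  unfold Machine.next
  split_ifs with h
  · simp [h]
  · simp [h, next_ne_nil _ hs.progress]

theorem Machine.Valid.potential_next_le {s : State} (hs : M.Valid s)
    (hg : ∀ h, M.run h ∈ M.states → κ * 63 + raceVal (fun a => Machine.rate P (leftKind a))
      (fun b => Machine.rate P (rightKind b)) (g (true :: h)) (g (false :: h)) 7 7 ≤ g h)
    {f : Item × Progress} (hf : f ∈ s.2.next) (hh : ¬ M.Halted s) :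
    Machine.potential P κ g (advance s.1 f.2).1 (advance s.1 f.2).2 ≤
      Machine.potential P κ g s.1 f.2 := by
  rcases next_mem _ hs.progress f hf with h | ⟨h, ht⟩
  · rw [Machine.advance_of_mem _ h]
  · have hadv : advance s.1 f.2 = (f.2.o :: s.1, Progress.zero) := if_pos (by rw [h])
    have hm : f.2.m ≠ 0 := by
      rw [h]
      exact (lt_length_of_mem _ hs.progress).ne_bot
    have hrun : M.run (f.2.o :: s.1) ∈ M.states := by
      by_contra hns
      refine hh ⟨?_, f, hf, ht⟩
      rwa [h] at hns
    rw [hadv]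
    -- A new gadget starts with the full cost `κ * 63` and a full race, which is the left side of
    -- `hg`.
    refine le_trans ?_ ((hg _ hrun).trans ?_)
    · simp [Machine.potential, Machine.outcomeVal, Progress.zero, Progress.count]
    · simp [Machine.potential, Machine.outcomeVal, hm]

theorem Machine.Valid.stepOp_potential_le {s : State} (hs : M.Valid s)
    (hg : ∀ h, M.run h ∈ M.states → κ * 63 + raceVal (fun a => Machine.rate P (leftKind a))
      (fun b => Machine.rate P (rightKind b)) (g (true :: h)) (g (false :: h)) 7 7 ≤ g h)
    (hn : M.next s ≠ []) :
    stepOp P M.next (fun s => Machine.potential P κ g s.1 s.2) s + κ ≤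
      Machine.potential P κ g s.1 s.2 := by
  classical
  have hh : ¬ M.Halted s := fun h => hn (hs.next_eq_nil.2 h)
  have hcost : ∀ f ∈ s.2.next, κ * (63 - f.2.count : ℕ) + κ = κ * (63 - s.2.count : ℕ) := by
    intro f hf
    obtain ⟨h1, h2⟩ := count_next _ hs.progress f hf
    rw [show 63 - s.2.count = (63 - f.2.count) + 1 by omega]
    push_cast
    ring
  -- Outside the race an attachment only changes the count.
  by_cases hc : ∀ f ∈ s.2.next, Machine.outcomeVal P g s.1 f.2 = Machine.outcomeVal P g s.1 s.2
  · obtain ⟨f₀, hf₀⟩ := List.exists_mem_of_ne_nil _ (next_ne_nil _ hs.progress)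
    have hle : stepOp P M.next (fun s => Machine.potential P κ g s.1 s.2) s ≤
        κ * (63 - f₀.2.count : ℕ) + Machine.outcomeVal P g s.1 s.2 := by
      refine (stepOp_le_of_forall P (g := fun s' => (1 : State → ℝ≥0∞) s' *
        (κ * (63 - f₀.2.count : ℕ) + Machine.outcomeVal P g s.1 s.2)) ?_).trans ?_
      · intro e he
        obtain ⟨-, f, hf, rfl⟩ := Machine.mem_next.1 he
        simp only [Pi.one_apply, one_mul]
        refine (hs.potential_next_le hg hf hh).trans (le_of_eq ?_)
        rw [Machine.potential, hc f hf]
        congr 4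
        rw [(count_next _ hs.progress f hf).1, (count_next _ hs.progress f₀ hf₀).1]
      · rw [stepOp_mul_const, stepOp_one P M.represents hs hn, one_mul]
    refine (add_le_add_left hle κ).trans (le_of_eq ?_)
    rw [Machine.potential, ← hcost f₀ hf₀]
    ring
  · have hm : s.2.m = 0 := by
      by_contra hm
      apply hc
      intro f hf
      obtain ⟨h1, h2⟩ := outcome_next _ hs.progress hm f hf
      simp [Machine.outcomeVal, hm, h1, h2]
    have hrace : s.2.p = 38 ∧ s.2.i ≤ 6 ∧ s.2.j ≤ 6 := by
      refine (frame_or_race _ hs.progress hm).resolve_left fun h => hc fun f hf => ?_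
      obtain ⟨h1, h2, h3⟩ := h f hf
      simp only [Machine.outcomeVal, hm, h1, h2, h3, if_true]
    have hnext : s.2.next = [s.2.leftNext, s.2.rightNext] := by
      rw [Progress.next, if_neg (by omega), if_pos hm]
    have hleft := hs.potential_next_le hg (f := s.2.leftNext) (by simp [hnext]) hh
    have hright := hs.potential_next_le hg (f := s.2.rightNext) (by simp [hnext]) hh
    have hcl := hcost s.2.leftNext (by simp [hnext])
    have hcr := hcost s.2.rightNext (by simp [hnext])
    obtain ⟨k1, k2, k3, k4⟩ := kind_arms _ hs.progress
    -- The competing tiles are stateless, so their concentrations are the rates of `raceVal`,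
    -- independent of the gadget.
    have hstep : stepOp P M.next (fun s => Machine.potential P κ g s.1 s.2) s =
        mix (Machine.rate P (leftKind (7 - s.2.i))) (Machine.rate P (rightKind (7 - s.2.j)))
          (Machine.potential P κ g (advance s.1 s.2.leftNext.2).1 (advance s.1 s.2.leftNext.2).2)
          (Machine.potential P κ g (advance s.1 s.2.rightNext.2).1
            (advance s.1 s.2.rightNext.2).2) := by
      rw [← k1, ← k2]
      unfold stepOp Machine.next
      rw [if_neg hh, hnext]
      simp only [List.map_cons, List.map_nil, List.sum_cons, List.sum_nil, add_zero, Machine.place,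
        M.tile_eq_of_lt k3 _ M.start, M.tile_eq_of_lt k4 _ M.start]
      rfl
    have hl : Machine.outcomeVal P g s.1 s.2.leftNext.2 =
        raceVal (fun a => Machine.rate P (leftKind a)) (fun b => Machine.rate P (rightKind b))
          (g (true :: s.1)) (g (false :: s.1)) (6 - s.2.i) (7 - s.2.j) := by
      unfold Progress.leftNext
      split_ifs with h6
      · simp only [Machine.outcomeVal, hm, if_true]
        congr 1
        omega
      · rw [show 6 - s.2.i = 0 by omega, raceVal]
        simp [Machine.outcomeVal]
    have hr : Machine.outcomeVal P g s.1 s.2.rightNext.2 =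
        raceVal (fun a => Machine.rate P (leftKind a)) (fun b => Machine.rate P (rightKind b))
          (g (true :: s.1)) (g (false :: s.1)) (7 - s.2.i) (6 - s.2.j) := by
      unfold Progress.rightNext
      split_ifs with h6
      · simp only [Machine.outcomeVal, hm, if_true]
        congr 1
        omega
      · rw [show 6 - s.2.j = 0 by omega, show 7 - s.2.i = (6 - s.2.i) + 1 by omega, raceVal]
        simp [Machine.outcomeVal]
    have hv : Machine.outcomeVal P g s.1 s.2 =
        mix (Machine.rate P (leftKind (7 - s.2.i))) (Machine.rate P (rightKind (7 - s.2.j)))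
          (Machine.outcomeVal P g s.1 s.2.leftNext.2)
          (Machine.outcomeVal P g s.1 s.2.rightNext.2) := by
      rw [hl, hr, Machine.outcomeVal, if_pos hm, show 7 - s.2.i = (6 - s.2.i) + 1 by omega,
        show 7 - s.2.j = (6 - s.2.j) + 1 by omega, raceVal]
    have h1 := Machine.rate_ne P ((kind_lt (7 - s.2.i)).1.trans (by omega))
    have h2 := Machine.rate_ne P ((kind_lt (7 - s.2.j)).2.trans (by omega))
    rw [hstep]
    refine (add_le_add_left (mix_mono _ _ hleft hright) κ).trans (le_of_eq ?_)
    simp only [Machine.potential]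
    rw [mix_add, ← hv]
    have hceq : (63 - s.2.leftNext.2.count : ℕ) = (63 - s.2.rightNext.2.count : ℕ) := by
      rw [(count_next _ hs.progress _ (show s.2.leftNext ∈ s.2.next by simp [hnext])).1,
        (count_next _ hs.progress _ (show s.2.rightNext ∈ s.2.next by simp [hnext])).1]
    rw [← hceq, mix_self h1.1 h1.2 h2.2, ← hcl]
    ring

end Potential


/-! ### Fair bits from biased outcomes, and rejection sampling. -/

section Generator

/-- The number of random bits drawn so far, their value, and an outcome that awaits its partner. -/
abbrev Counter := ℕ × ℕ × Option Bool

/-- Two different outcomes yield a random bit, and equal ones are ignored. The drawing of `k` bits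
starts again if their value is not below `n`. -/
def drawStep (n k : ℕ) : Counter → Bool → Counter
  | (i, a, none), o => (i, a, some o)
  | (i, a, some b), o =>
    -- The bit is the earlier outcome `b` of the pair; after `k` bits nothing more is drawn.
    if o = b ∨ k ≤ i then (i, a, none)
    else if i + 1 = k ∧ n ≤ 2 * a + b.toNat then (0, 0, none) else (i + 1, 2 * a + b.toNat, none)

def draw (n k : ℕ) : List Bool → Counter
  | [] => (0, 0, none)
  | o :: h => drawStep n k (draw n k h) o

/-- The machine keeps the comparison of the value with the leading bits of `n`. -/
def compareStep (n k : ℕ) : ℕ × Ordering × Option Bool → Bool → ℕ × Ordering × Option Bool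
  | (i, c, none), o => (i, c, some o)
  | (i, c, some b), o =>
    if o = b ∨ k ≤ i then (i, c, none)
    else if i + 1 = k ∧ c.then (compare b.toNat (n / 2 ^ (k - (i + 1)) % 2)) ≠ Ordering.lt then
      (0, Ordering.eq, none)
    else (i + 1, c.then (compare b.toNat (n / 2 ^ (k - (i + 1)) % 2)), none)

/-- Every outcome toggles whether one is pending. -/
theorem compareStep_ne (n k : ℕ) (q : ℕ × Ordering × Option Bool) (o : Bool) :
    compareStep n k q o ≠ q := by
  rcases q with ⟨i, c, _ | b⟩
  · simp [compareStep]
  · simp only [compareStep]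
    split_ifs <;> simp

/-- Having drawn `k` bits means having halted. Three comparisons and three pending values give the
factor 9. -/
def generatorStates (k : ℕ) : Finset (ℕ × Ordering × Option Bool) :=
  Finset.range k ×ˢ {Ordering.lt, Ordering.eq, Ordering.gt} ×ˢ Finset.univ

theorem mem_generatorStates {k : ℕ} {q : ℕ × Ordering × Option Bool} :
    q ∈ generatorStates k ↔ q.1 < k := by
  rcases q with ⟨i, c, b⟩
  cases c <;> simp [generatorStates]

theorem card_generatorStates (k : ℕ) : (generatorStates k).card = 9 * k := by
  rw [generatorStates, Finset.card_product, Finset.card_product, Finset.card_range]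
  have : ({Ordering.lt, Ordering.eq, Ordering.gt} : Finset Ordering).card = 3 := by decide
  rw [this, Finset.card_univ]
  simp
  ring

/-- The machine that draws a random number below `n` by means of `k` bits. -/
def generator (n k : ℕ) (hk : 0 < k) : Machine (ℕ × Ordering × Option Bool) where
  δ := compareStep n k
  states := generatorStates k
  start := (0, Ordering.eq, none)
  start_mem := mem_generatorStates.2 hk
  δ_ne := compareStep_ne n k

variable {n k : ℕ}

/-- Appending a bit refines the comparison lexicographically, so the machine may forget the value.
-/
theorem compare_two_mul_add (a m : ℕ) (b : Bool) :
    compare (2 * a + b.toNat) m = (compare a (m / 2)).then (compare b.toNat (m % 2)) := by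
  have hb : b.toNat ≤ 1 := b.toNat_le
  rcases lt_trichotomy a (m / 2) with h | h | h
  · rw [compare_lt_iff_lt.2 h, compare_lt_iff_lt.2 (by omega)]
    rfl
  · rw [compare_eq_iff_eq.2 h]
    rcases lt_trichotomy b.toNat (m % 2) with h' | h' | h'
    · rw [compare_lt_iff_lt.2 h', compare_lt_iff_lt.2 (by omega)]; rfl
    · rw [compare_eq_iff_eq.2 h', compare_eq_iff_eq.2 (by omega)]; rfl
    · rw [compare_gt_iff_gt.2 h', compare_gt_iff_gt.2 (by omega)]; rfl
  · rw [compare_gt_iff_gt.2 h, compare_gt_iff_gt.2 (by omega)]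
    rfl

/-- The state of the machine that belongs to a counter. -/
def Counter.abstract (n k : ℕ) (c : Counter) : ℕ × Ordering × Option Bool :=
  (c.1, compare c.2.1 (n / 2 ^ (k - c.1)), c.2.2)

theorem compareStep_abstract (hn : n < 2 ^ k) (c : Counter) (o : Bool) :
    compareStep n k (c.abstract n k) o = (drawStep n k c o).abstract n k := by
  rcases c with ⟨i, a, _ | b⟩
  · rfl
  · simp only [Counter.abstract, compareStep, drawStep]
    by_cases h : o = b ∨ k ≤ i
    · simp only [if_pos h]
    · rw [if_neg h, if_neg h]
      have hcmp : (compare a (n / 2 ^ (k - i))).then (compare b.toNat (n / 2 ^ (k - (i + 1)) % 2)) =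
          compare (2 * a + b.toNat) (n / 2 ^ (k - (i + 1))) := by
        rw [compare_two_mul_add, Nat.div_div_eq_div_mul, ← pow_succ,
          show k - (i + 1) + 1 = k - i by omega]
      rw [hcmp]
      -- After the last bit the leading part of `n` is `n` itself.
      have hiff : (i + 1 = k ∧ compare (2 * a + b.toNat) (n / 2 ^ (k - (i + 1))) ≠ Ordering.lt) ↔
          (i + 1 = k ∧ n ≤ 2 * a + b.toNat) := by
        refine and_congr_right fun hik => ?_
        rw [hik, Nat.sub_self, pow_zero, Nat.div_one, ne_eq, compare_lt_iff_lt, not_lt]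
      by_cases h2 : i + 1 = k ∧ n ≤ 2 * a + b.toNat
      · rw [if_pos (hiff.2 h2), if_pos h2]
        simp only [Nat.sub_zero, Nat.div_eq_of_lt hn]
        rfl
      · rw [if_neg (fun h => h2 (hiff.1 h)), if_neg h2]

theorem run_generator (hk : 0 < k) (hn : n < 2 ^ k) (h : List Bool) :
    (generator n k hk).run h = (draw n k h).abstract n k := by
  induction h with
  | nil => simp [Machine.run, draw, Counter.abstract, generator, Nat.div_eq_of_lt hn]
  | cons o h ih => rw [Machine.run, ih]; exact compareStep_abstract hn _ _

theorem run_generator_mem (hk : 0 < k) (hn : n < 2 ^ k) (h : List Bool) :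
    (generator n k hk).run h ∈ (generator n k hk).states ↔ (draw n k h).1 < k := by
  rw [run_generator hk hn]
  exact mem_generatorStates

theorem draw_lt (hk : 0 < k) (h : List Bool) (hi : k ≤ (draw n k h).1) : (draw n k h).2.1 < n := by
  induction h with
  | nil => simp [draw] at hi; omega
  | cons o h ih =>
    rw [draw] at hi ⊢
    generalize draw n k h = c at *
    rcases c with ⟨i, a, _ | b⟩
    · exact ih hi
    · simp only [drawStep] at hi ih ⊢
      split_ifs at hi ⊢ with h1 h2
      · exact ih hi
      · omega
      · simp only at hi
        simp only
        omega

/-- A bound for the expected costs when `r` bits remain to be drawn and the value of the previous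
bits is `a`: each bit costs `c`, the value `u` costs `term u`, and a restart costs `F₀`. -/
noncomputable def bitVal (n : ℕ) (c : ℝ≥0∞) (term : ℕ → ℝ≥0∞) (F₀ : ℝ≥0∞) : ℕ → ℕ → ℝ≥0∞
  | 0, u => if u < n then term u else F₀
  | r + 1, a => c + (bitVal n c term F₀ r (2 * a) + bitVal n c term F₀ r (2 * a + 1)) / 2

variable {c F₀ : ℝ≥0∞} {term : ℕ → ℝ≥0∞}

/-- Unrolled over the binary tree: each of the `r` levels costs `c`, and the 2^r leaves are equally
likely. -/
theorem bitVal_eq (r a : ℕ) : bitVal n c term F₀ r a =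
    r * c + (∑ u ∈ Finset.range (2 ^ r), bitVal n c term F₀ 0 (a * 2 ^ r + u)) / 2 ^ r := by
  induction r generalizing a with
  | zero => simp
  | succ r ih =>
    rw [bitVal, ih, ih]
    have hsum : ∑ u ∈ Finset.range (2 ^ (r + 1)), bitVal n c term F₀ 0 (a * 2 ^ (r + 1) + u) =
        ∑ u ∈ Finset.range (2 ^ r), bitVal n c term F₀ 0 (2 * a * 2 ^ r + u) +
        ∑ u ∈ Finset.range (2 ^ r), bitVal n c term F₀ 0 ((2 * a + 1) * 2 ^ r + u) := by
      rw [pow_succ, mul_two, Finset.sum_range_add]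
      congr 1 <;> refine Finset.sum_congr rfl fun u _ => ?_ <;> congr 1 <;> ring
    rw [hsum]
    generalize ∑ u ∈ Finset.range (2 ^ r), bitVal n c term F₀ 0 (2 * a * 2 ^ r + u) = A
    generalize ∑ u ∈ Finset.range (2 ^ r), bitVal n c term F₀ 0 ((2 * a + 1) * 2 ^ r + u) = B
    have h2 : (2 : ℝ≥0∞)⁻¹ + 2⁻¹ = 1 := ENNReal.inv_two_add_inv_two
    have hinv : ((2 : ℝ≥0∞) ^ (r + 1))⁻¹ = (2 ^ r)⁻¹ * 2⁻¹ := by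
      rw [pow_succ, ENNReal.mul_inv (Or.inr (by simp)) (Or.inr (by simp))]
    simp only [div_eq_mul_inv, hinv]
    push_cast
    calc _ = c + r * c * (2⁻¹ + 2⁻¹) + (A + B) * ((2 ^ r)⁻¹ * 2⁻¹) := by ring
      _ = _ := by rw [h2]; ring

theorem bitVal_ne_top (hc : c ≠ ⊤) (ht : ∀ u, term u ≠ ⊤) (hF : F₀ ≠ ⊤) (r a : ℕ) :
    bitVal n c term F₀ r a ≠ ⊤ := by
  induction r generalizing a with
  | zero => unfold bitVal; split_ifs; exacts [ht _, hF]
  | succ r ih =>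
    rw [bitVal]
    exact ENNReal.add_ne_top.2 ⟨hc, ENNReal.div_ne_top (ENNReal.add_ne_top.2 ⟨ih _, ih _⟩) two_ne_zero⟩

/-- A bound for the expected costs from a counter, where each outcome costs `K` and is `true` with
probability `α`. -/
noncomputable def drawVal (k : ℕ) (F : ℕ → ℕ → ℝ≥0∞) (α β K : ℝ≥0∞) : Counter → ℝ≥0∞
  | (i, a, none) => F (k - i) a
  | (i, a, some true) => K + (α * F (k - i) a + β * F (k - (i + 1)) (2 * a + 1))
  | (i, a, some false) => K + (α * F (k - (i + 1)) (2 * a) + β * F (k - i) a)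

theorem drawVal_ne_top {F : ℕ → ℕ → ℝ≥0∞} (hF : ∀ r a, F r a ≠ ⊤) {α β K : ℝ≥0∞} (hα : α ≠ ⊤)
    (hβ : β ≠ ⊤) (hK : K ≠ ⊤) (c : Counter) : drawVal k F α β K c ≠ ⊤ := by
  rcases c with ⟨i, a, _ | _ | _⟩
  · exact hF _ _
  · exact ENNReal.add_ne_top.2 ⟨hK, ENNReal.add_ne_top.2
      ⟨ENNReal.mul_ne_top hα (hF _ _), ENNReal.mul_ne_top hβ (hF _ _)⟩⟩
  · exact ENNReal.add_ne_top.2 ⟨hK, ENNReal.add_ne_top.2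
      ⟨ENNReal.mul_ne_top hα (hF _ _), ENNReal.mul_ne_top hβ (hF _ _)⟩⟩

/-- Von Neumann's trick: a pair costs 2K and yields either bit with probability αβ, so a bit costs
K/(αβ) ≤ c on average. The computation avoids division by using 2S = 2c + T₀ + T₁ and (α + β)² = 1.
-/
theorem drawVal_step_le {α β K : ℝ≥0∞} (hF : bitVal n c term F₀ k 0 ≤ F₀) (hαβ : α + β = 1)
    (hK : K ≤ α * β * c) (s : Counter) (hs : s.1 < k) :
    K + (α * drawVal k (bitVal n c term F₀) α β K (drawStep n k s true) +
      β * drawVal k (bitVal n c term F₀) α β K (drawStep n k s false)) ≤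
    drawVal k (bitVal n c term F₀) α β K s := by
  -- A rejected value leads to a restart, whose value is at most `F₀` by `hF`.
  have hbit : ∀ i a b, i < k → drawVal k (bitVal n c term F₀) α β K
      (if i + 1 = k ∧ n ≤ 2 * a + Bool.toNat b then (0, 0, none)
        else (i + 1, 2 * a + Bool.toNat b, none)) ≤
      bitVal n c term F₀ (k - (i + 1)) (2 * a + Bool.toNat b) := by
    intro i a b hi
    split_ifs with h
    · rw [drawVal, Nat.sub_zero, h.1, Nat.sub_self]
      refine hF.trans (le_of_eq ?_)
      rw [bitVal, if_neg (by omega)]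
    · rw [drawVal]
  rcases s with ⟨i, a, _ | _ | _⟩
  · simp only at hs
    simp only [drawStep, drawVal]
    have hS : bitVal n c term F₀ (k - i) a = c + (bitVal n c term F₀ (k - (i + 1)) (2 * a) +
        bitVal n c term F₀ (k - (i + 1)) (2 * a + 1)) / 2 := by
      rw [show k - i = (k - (i + 1)) + 1 by omega, bitVal]
    generalize bitVal n c term F₀ (k - (i + 1)) (2 * a) = T₀ at *
    generalize bitVal n c term F₀ (k - (i + 1)) (2 * a + 1) = T₁ at *
    generalize bitVal n c term F₀ (k - i) a = S at *
    have h2 : (2 : ℝ≥0∞) * 2⁻¹ = 1 := ENNReal.mul_inv_cancel two_ne_zero (by simp)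
    have hS2 : 2 * S = 2 * c + (T₀ + T₁) := by
      rw [hS, div_eq_mul_inv]
      calc _ = 2 * c + (T₀ + T₁) * (2 * 2⁻¹) := by ring
        _ = _ := by rw [h2, mul_one]
    calc K + (α * (K + (α * S + β * T₁)) + β * (K + (α * T₀ + β * S)))
        = K + (α + β) * K + (α * α + β * β) * S + α * β * (T₀ + T₁) := by ring
      _ ≤ α * β * c + α * β * c + (α * α + β * β) * S + α * β * (T₀ + T₁) := by
        rw [hαβ, one_mul]; gcongr
      _ = α * β * (2 * c + (T₀ + T₁)) + (α * α + β * β) * S := by ring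
      _ = (α + β) * (α + β) * S := by rw [← hS2]; ring
      _ = S := by rw [hαβ]; ring
  · simp only at hs
    have hT := hbit i a false hs
    simp only [drawStep, drawVal, Bool.true_eq_false, false_or, true_or, if_true,
      if_neg (not_le.2 hs)] at hT ⊢
    gcongr
    simpa using hT
  · simp only at hs
    have hT := hbit i a true hs
    simp only [drawStep, drawVal, Bool.false_eq_true, false_or, true_or, if_true,
      if_neg (not_le.2 hs)] at hT ⊢
    gcongr
    simpa using hT

/-- 1/n is a fixed point of the restart: one leaf pays 1 and each of the 2^k - n rejected leaves
pays 1/n, in total 2^k/n. -/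
theorem bitVal_indicator (hn : 0 < n) (hnk : n ≤ 2 ^ k) {v : ℕ} (hv : v < n) :
    bitVal n 0 (fun u => if u = v then 1 else 0) (n : ℝ≥0∞)⁻¹ k 0 = (n : ℝ≥0∞)⁻¹ := by
  rw [bitVal_eq, mul_zero, zero_add]
  have hsum : ∑ u ∈ Finset.range (2 ^ k), bitVal n 0 (fun u => if u = v then 1 else 0)
      (n : ℝ≥0∞)⁻¹ 0 (0 * 2 ^ k + u) = 2 ^ k * (n : ℝ≥0∞)⁻¹ := by
    obtain ⟨d, hd⟩ := Nat.exists_eq_add_of_le hnk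
    rw [hd, Finset.sum_range_add]
    have h1 : ∑ u ∈ Finset.range n, bitVal n 0 (fun u => if u = v then 1 else 0)
        (n : ℝ≥0∞)⁻¹ 0 (0 * (n + d) + u) = 1 := by
      rw [Finset.sum_congr rfl (g := fun u => if u = v then 1 else 0) fun u hu => by
        rw [zero_mul, zero_add, bitVal, if_pos (Finset.mem_range.1 hu)]]
      rw [Finset.sum_ite_eq' (Finset.range n) v fun _ => (1 : ℝ≥0∞),
        if_pos (Finset.mem_range.2 hv)]
    have h2 : ∑ u ∈ Finset.range d, bitVal n 0 (fun u => if u = v then 1 else 0)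
        (n : ℝ≥0∞)⁻¹ 0 (0 * (n + d) + (n + u)) = d * (n : ℝ≥0∞)⁻¹ := by
      rw [Finset.sum_congr rfl (g := fun _ => (n : ℝ≥0∞)⁻¹) fun u hu => by
        rw [zero_mul, zero_add, bitVal, if_neg (by omega)]]
      simp
    have hpow : ((2 : ℝ≥0∞) ^ k) = n + d := by exact_mod_cast congrArg (Nat.cast : ℕ → ℝ≥0∞) hd
    rw [h1, h2, hpow, add_mul, ENNReal.mul_inv_cancel (by exact_mod_cast hn.ne') (by simp)]
  rw [hsum, mul_comm, ENNReal.mul_div_right_comm, mul_comm, ENNReal.mul_div_cancel' (by simp) (by simp)]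

/-- At most half of the leaves are rejected, so restarts add at most kc to the kc for the bits. -/
theorem bitVal_const (hkn : 2 ^ k ≤ 2 * n) :
    bitVal n c 0 (2 * k * c) k 0 ≤ 2 * k * c := by
  rw [bitVal_eq]
  have hsum : ∑ u ∈ Finset.range (2 ^ k), bitVal n c 0 (2 * k * c) 0 (0 * 2 ^ k + u) ≤
      2 ^ k * (k * c) := by
    calc _ ≤ ∑ u ∈ Finset.range (n + (2 ^ k - n)), bitVal n c 0 (2 * k * c) 0 (0 * 2 ^ k + u) :=
          Finset.sum_le_sum_of_subset (Finset.range_subset_range.2 (by omega))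
      _ = ((2 ^ k - n : ℕ) : ℝ≥0∞) * (2 * k * c) := by
        rw [Finset.sum_range_add, Finset.sum_eq_zero, zero_add,
          Finset.sum_congr rfl (g := fun _ => 2 * k * c) fun u hu => by
            rw [zero_mul, zero_add, bitVal, if_neg (by omega)]]
        · simp
        · intro u hu
          rw [zero_mul, zero_add, bitVal, if_pos (Finset.mem_range.1 hu)]
          rfl
      _ = ((2 * (2 ^ k - n) : ℕ) : ℝ≥0∞) * (k * c) := by push_cast; ring
      _ ≤ ((2 ^ k : ℕ) : ℝ≥0∞) * (k * c) := by
        have hp : 0 < 2 ^ k := by positivity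
        gcongr
        omega
      _ = 2 ^ k * (k * c) := by push_cast; rfl
  calc _ ≤ k * c + 2 ^ k * (k * c) / 2 ^ k := by gcongr
    _ = k * c + k * c := by
      rw [ENNReal.mul_div_right_comm, ENNReal.div_self (by simp) (by simp), one_mul]
    _ = 2 * k * c := by ring

end Generator


/-! ### Reachable states and the frontier. -/

section Payoff

variable {G : Type} {Γ : TileSystem G} {S : Type} {asm : S → Assembly G}
  {next : S → List (PlacedTile G × S)} {V : S → Prop}

/-- Terminal assemblies must be producible, so rewards at terminal assemblies are evaluated on
reachable states. -/
theorem Represents.reach (hR : Represents Γ asm next V) (s₀ : S) :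
    Represents Γ asm next (fun s => V s ∧ Reach next s₀ s) where
  closed hs e he := ⟨hR.closed hs.1 e he, hs.2.tail ⟨e.1, he⟩⟩
  attaches hs := hR.attaches hs.1
  frontier hs := hR.frontier hs.1
  nodup hs := hR.nodup hs.1

theorem exists_reach_of_expect_ne_zero (P : Concentration Γ.tileSet) {g : S → ℝ≥0∞} {k : ℕ} {s : S}
    (h : expect P next k g s ≠ 0) : ∃ t, Reach next s t ∧ g t ≠ 0 := by
  induction k generalizing s with
  | zero => exact ⟨s, Relation.ReflTransGen.refl, h⟩
  | succ k ih =>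
    rw [expect] at h
    obtain ⟨e, he, hne⟩ : ∃ e ∈ next s, expect P next k g e.2 ≠ 0 := by
      by_contra hcon
      push Not at hcon
      apply h
      unfold stepOp
      apply List.sum_eq_zero
      intro x hx
      obtain ⟨e, he, rfl⟩ := List.mem_map.1 hx
      rw [hcon e he, mul_zero]
    obtain ⟨t, ht, hg⟩ := ih hne
    exact ⟨t, Relation.ReflTransGen.head ⟨e.1, he⟩ ht, hg⟩

theorem Represents.encard_frontier_le (hR : Represents Γ asm next V) {s : S} (hs : V s) {k : ℕ}
    (hk : (next s).length ≤ k) : (PlacedTile.pos '' Γ.frontier (asm s)).encard ≤ k := by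
  classical
  have hsub : PlacedTile.pos '' Γ.frontier (asm s) ⊆
      (((next s).map fun e => e.1.pos).toFinset : Set (ℤ × ℤ)) := by
    rintro _ ⟨b, hb, rfl⟩
    obtain ⟨t, ht⟩ := hR.frontier hs b hb
    simp only [List.coe_toFinset, Set.mem_ofPred_eq, List.mem_map]
    exact ⟨_, ht, rfl⟩
  refine (Set.encard_le_encard hsub).trans ?_
  rw [Set.encard_coe_eq_coe_finsetCard]
  refine Nat.cast_le.2 ((List.toFinset_card_le _).trans ?_)
  rwa [List.length_map]

end Payoff

/-! ### Reading outcomes from assemblies; probabilities and expected space. -/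

section Outcomes

variable {Q : Type} [DecidableEq Q] {M : Machine Q}

/-- The initial state. -/
def State.start : State := ([], Progress.zero)

/-- The outcomes up to the present gadget. -/
def State.word (s : State) : List Bool := s.2.o :: s.1

theorem Machine.valid_start (M : Machine Q) : M.Valid State.start where
  progress := zero_mem
  running h hh := by
    rw [List.suffix_nil.1 hh]
    exact M.start_mem
  stable := by
    classical
    have : (M.assembly State.start).tiles = {M.place M.start M.start 0 entryItem} := by
      ext a
      rw [M.mem_assembly, Finset.mem_singleton]
      simp [State.start, Machine.tiles, Progress.items, Progress.zero, Machine.oldTiles]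
    intro S hS hne hne'
    rw [this] at hS hne'
    exact absurd ((Finset.subset_singleton_iff.1 hS).resolve_left hne.ne_empty) hne'

theorem Machine.Valid.m_ne_zero {s : State} (hs : M.Valid s) (h : M.Halted s) : s.2.m ≠ 0 := by
  obtain ⟨-, e, he, ht⟩ := h
  exact m_ne_zero_of_tag _ hs.progress e he ht

theorem exists_claim_of_mem {l : List Item} {o : Bool} (h : (claimItems o).getD 0 default ∈ l)
    (q q' : Q) (k : ℕ) : ∃ a ∈ l.map (M.place q q' k), a.pos = (((11 * k + 5 : ℕ) : ℤ), 4) ∧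
      a.tile.north.1 = if o then 14 else 15 := by
  refine ⟨_, List.mem_map_of_mem h, ?_, ?_⟩
  · cases o <;> rfl
  · cases o <;> rfl

theorem exists_claim_old (o : Bool) (w h : List Bool) (hw : (o :: w) <:+ h) :
    ∃ a ∈ M.oldTiles h, a.pos = (((11 * w.length + 5 : ℕ) : ℤ), 4) ∧
      a.tile.north.1 = if o then 14 else 15 := by
  induction h with
  | nil => simp at hw
  | cons o' h ih =>
    rcases List.suffix_cons_iff.1 hw with hw | hw
    · obtain ⟨rfl, rfl⟩ := List.cons.inj hw
      have hmem : ∀ o, (claimItems o).getD 0 default ∈ fullItems o := by decide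
      obtain ⟨a, ha, h⟩ := exists_claim_of_mem (M := M) (hmem o) (M.run w) (M.run (o :: w)) w.length
      exact ⟨a, List.mem_append_right _ ha, h⟩
    · obtain ⟨a, ha, h⟩ := ih hw
      exact ⟨a, List.mem_append_left _ ha, h⟩

/-- The outcomes can be read off from the assembly. -/
theorem exists_claim {s : State} (hm : s.2.m ≠ 0) {o : Bool} {w : List Bool}
    (hw : (o :: w) <:+ s.word) :
    ∃ a ∈ (M.assembly s).tiles, a.pos = (((11 * w.length + 5 : ℕ) : ℤ), 4) ∧
      a.tile.north.1 = if o then 14 else 15 := by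
  simp only [M.mem_assembly]
  rcases List.suffix_cons_iff.1 hw with hw | hw
  · obtain ⟨rfl, rfl⟩ := List.cons.inj hw
    have hmem : (claimItems s.2.o).getD 0 default ∈ s.2.items := by
      obtain ⟨m, hm⟩ := Nat.exists_eq_succ_of_ne_zero hm
      apply List.mem_append_right
      rw [hm]
      cases s.2.o <;> exact List.mem_cons_self
    obtain ⟨a, ha, h⟩ := exists_claim_of_mem (M := M) hmem (M.run s.1) (M.run (s.2.o :: s.1))
      s.1.length
    exact ⟨a, List.mem_append_right _ ha, h⟩
  · obtain ⟨a, ha, h⟩ := exists_claim_old (M := M) o w s.1 hw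
    exact ⟨a, List.mem_append_left _ ha, h⟩

/-- Words are compared from the oldest outcome on: the north glue, 14 or 15, of the tile in each
claimed cell reveals the winner. -/
theorem suffix_of_assembly_eq {s t : State} (hs : s.2.m ≠ 0) (ht : t.2.m ≠ 0)
    (h : M.assembly s = M.assembly t) (u : List Bool) (hu : u <:+ s.word)
    (hlen : u.length ≤ t.word.length) : u <:+ t.word := by
  induction u with
  | nil => exact List.nil_suffix
  | cons o u ih =>
    obtain ⟨p, hp⟩ := ih ((List.suffix_cons o u).trans hu) (by simp at hlen; omega)
    rcases List.eq_nil_or_concat p with rfl | ⟨p, o', rfl⟩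
    · rw [List.nil_append] at hp
      rw [← hp] at hlen
      simp at hlen
    · have hu' : (o' :: u) <:+ t.word := ⟨p, by rw [← hp]; simp⟩
      obtain ⟨a, ha, hpos, hno⟩ := exists_claim (M := M) hs hu
      obtain ⟨b, hb, hpos', hno'⟩ := exists_claim (M := M) ht hu'
      rw [← h] at hb
      have hab := (M.assembly s).pos_unique a ha b hb (hpos.trans hpos'.symm)
      rw [← hab, hno] at hno'
      have : o = o' := by
        revert hno'
        cases o <;> cases o' <;> simp
      rwa [this]

/-- A proper suffix of the word of `t` leads to a running state, whereas the word of `s` leads to a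
halt. -/
theorem Machine.Valid.word_eq_of_length_le {s t : State} (hs : M.Valid s) (ht : M.Valid t)
    (hs' : M.Halted s) (ht' : M.Halted t) (h : M.assembly s = M.assembly t)
    (hlen : s.word.length ≤ t.word.length) : s.word = t.word := by
  have hsuf := suffix_of_assembly_eq (hs.m_ne_zero hs') (ht.m_ne_zero ht') h _
    (List.suffix_refl _) hlen
  exact (List.suffix_cons_iff.1 hsuf).resolve_right fun h' => hs'.1 (ht.running _ h')

theorem Machine.Valid.word_eq {s t : State} (hs : M.Valid s) (ht : M.Valid t)
    (hs' : M.Halted s) (ht' : M.Halted t) (h : M.assembly s = M.assembly t) : s.word = t.word := by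
  rcases le_total s.word.length t.word.length with hlen | hlen
  · exact hs.word_eq_of_length_le ht hs' ht' h hlen
  · exact (ht.word_eq_of_length_le hs ht' hs' h.symm hlen).symm

variable {P : Concentration M.system.tileSet} {κ : ℝ≥0∞} {g : List Bool → ℝ≥0∞}

theorem Machine.Valid.le_potential {s : State} (hs : M.Valid s) (hh : M.Halted s) :
    g s.word ≤ Machine.potential P κ g s.1 s.2 := by
  rw [Machine.potential, Machine.outcomeVal, if_neg (hs.m_ne_zero hh)]
  exact le_add_self

theorem Machine.potential_start (hg : κ * 63 + raceVal (fun a => Machine.rate P (leftKind a))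
    (fun b => Machine.rate P (rightKind b)) (g [true]) (g [false]) 7 7 ≤ g []) :
    Machine.potential P κ g [] Progress.zero ≤ g [] := by
  refine le_trans (le_of_eq ?_) hg
  simp [Machine.potential, Machine.outcomeVal, Progress.zero, Progress.count]

theorem Machine.potential_ne_top (hκ : κ ≠ ⊤) (hg : ∀ h, g h ≠ ⊤) (h : List Bool) (σ : Progress) :
    Machine.potential P κ g h σ ≠ ⊤ := by
  refine ENNReal.add_ne_top.2 ⟨ENNReal.mul_ne_top hκ (by simp), ?_⟩
  unfold Machine.outcomeVal
  split_ifs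
  · exact raceVal_ne_top (fun a => Machine.rate_ne P ((kind_lt a).1.trans (by omega)))
      (fun a => Machine.rate_ne P ((kind_lt a).2.trans (by omega))) (hg _) (hg _) _ _
  · exact hg _

open Classical in
/-- The expected payoff at the end is at most `g []`. -/
theorem Machine.tsum_payoff_le (hg : ∀ h, M.run h ∈ M.states →
    0 * 63 + raceVal (fun a => Machine.rate P (leftKind a))
      (fun b => Machine.rate P (rightKind b)) (g (true :: h)) (g (false :: h)) 7 7 ≤ g h)
    (pay : State → ℝ≥0∞) (hpay : ∀ s, M.Valid s → M.Halted s → pay s ≤ g s.word) :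
    ∑' k, expect P M.next k (fun s => if M.next s = [] then pay s else 0) State.start ≤ g [] := by
  refine (M.represents.tsum_expect_le P (f := fun s => Machine.potential P 0 g s.1 s.2)
    M.valid_start fun s hs => ?_).trans (Machine.potential_start (hg [] M.start_mem))
  split_ifs with hn
  · have hh := hs.next_eq_nil.1 hn
    rw [stepOp, hn]
    simpa using (hpay s hs hh).trans (hs.le_potential hh)
  · exact hs.stepOp_potential_le hg hn

open Classical in
theorem Machine.Valid.tsum_expect_halted {s : State} (hs : M.Valid s) (hg : ∀ h, M.run h ∈ M.states →
    1 * 63 + raceVal (fun a => Machine.rate P (leftKind a))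
      (fun b => Machine.rate P (rightKind b)) (g (true :: h)) (g (false :: h)) 7 7 ≤ g h)
    (hfin : ∀ h, g h ≠ ⊤) :
    ∑' k, expect P M.next k (fun s => if M.next s = [] then 1 else 0) s = 1 :=
  M.represents.tsum_expect_end P hs (f := fun s => Machine.potential P 1 g s.1 s.2)
    (Machine.potential_ne_top (by simp) hfin _ _) fun _ ht hn => ht.stepOp_potential_le hg hn

theorem Machine.Valid.space_next {s : State} (hs : M.Valid s) {e : PlacedTile (Glue Q) × State}
    (he : e ∈ M.next s) : (M.assembly e.2).space = (M.assembly s).space + 1 := by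
  classical
  obtain ⟨-, h1, h2, -⟩ := hs.attaches he
  rw [Assembly.space, Assembly.space, h2, Finset.card_insert_of_notMem h1]

open Classical in
-- The potential is augmented by the current size: a step adds one tile and lowers the expected
-- potential by at least one.
theorem Machine.tsum_space_le (hg : ∀ h, M.run h ∈ M.states →
    1 * 63 + raceVal (fun a => Machine.rate P (leftKind a))
      (fun b => Machine.rate P (rightKind b)) (g (true :: h)) (g (false :: h)) 7 7 ≤ g h) :
    ∑' k, expect P M.next k (fun s => if M.next s = [] then ((M.assembly s).space : ℝ≥0∞) else 0)
      State.start ≤ g [] + (M.assembly State.start).space := by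
  refine (M.represents.tsum_expect_le P
    (f := fun s => Machine.potential P 1 g s.1 s.2 + (M.assembly s).space)
    M.valid_start fun s hs => ?_).trans
      (add_le_add_left (Machine.potential_start (hg [] M.start_mem)) _)
  split_ifs with hn
  · rw [stepOp, hn]
    simp
  · have h1 : stepOp P M.next (fun s => ((M.assembly s).space : ℝ≥0∞)) s ≤
        (M.assembly s).space + 1 := by
      refine (stepOp_le_of_forall P (g := fun s' => (1 : State → ℝ≥0∞) s' *
        ((M.assembly s).space + 1)) ?_).trans ?_
      · intro e he
        rw [hs.space_next he]
        simp
      · rw [stepOp_mul_const, stepOp_one P M.represents hs hn, one_mul]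
    rw [stepOp_add, add_zero]
    refine (add_le_add_right h1 _).trans ?_
    rw [add_comm ((M.assembly s).space : ℝ≥0∞), ← add_assoc]
    gcongr
    exact hs.stepOp_potential_le hg hn

theorem Machine.space_start (M : Machine Q) : (M.assembly State.start).space = 1 := by
  classical
  rw [Assembly.space, Finset.card_eq_one]
  refine ⟨M.place M.start M.start 0 entryItem, ?_⟩
  ext a
  rw [M.mem_assembly, Finset.mem_singleton]
  simp [State.start, Machine.tiles, Progress.items, Progress.zero, Machine.oldTiles]

theorem Machine.extensible (M : Machine Q) : M.system.Extensible 2 := by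
  intro α hα
  obtain ⟨t, rfl, ht⟩ := M.represents.exists_of_grows M.valid_start hα
  have hv := (M.represents.of_reach M.valid_start ht).1
  refine M.represents.encard_frontier_le hv ?_
  unfold Machine.next
  split_ifs
  · simp
  · rw [List.length_map]
    exact length_next_le _ hv.progress

theorem Machine.mem_terminal_iff {t : State} (ht : M.Valid t)
    (hr : Reach M.next State.start t) : M.assembly t ∈ M.system.terminal ↔ M.next t = [] := by
  rw [← M.represents.frontier_eq_empty_iff ht]
  exact ⟨fun h => h.2, fun h => ⟨(M.represents.of_reach M.valid_start hr).2, h⟩⟩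

theorem Machine.isFinite
    (h : ∀ s, M.Valid s → ∃ t, Reach M.next s t ∧ M.next t = []) : M.system.IsFinite := by
  intro β hβ
  obtain ⟨s, rfl, hs⟩ := M.represents.exists_of_grows M.valid_start hβ
  have hv := (M.represents.of_reach M.valid_start hs).1
  obtain ⟨t, ht, hn⟩ := h s hv
  have ht' := M.represents.of_reach hv ht
  exact ⟨_, (Machine.mem_terminal_iff ht'.1 (hs.trans ht)).2 hn, ht'.2⟩

/-- The uniform concentrations. -/
theorem Machine.exists_concentration (M : Machine Q) : Nonempty (Concentration M.system.tileSet) := by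
  have hne : (M.system.tileSet.card : ℝ≥0) ≠ 0 := by
    have : M.tile 0 M.start ∈ M.system.tileSet := M.tile_start_mem (by omega)
    exact Nat.cast_ne_zero.2 (Finset.card_ne_zero_of_mem this)
  refine ⟨⟨fun _ => (M.system.tileSet.card : ℝ≥0)⁻¹, fun _ _ => ?_, ?_⟩⟩
  · exact inv_pos.2 (pos_iff_ne_zero.2 hne)
  · rw [Finset.sum_const, nsmul_eq_mul, mul_inv_cancel₀ hne]

/-- The terminal assemblies in which the outcomes have the value `v`. -/
def Machine.terminalWith (M : Machine Q) (value : List Bool → ℕ) (v : ℕ) :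
    Set (Assembly (Glue Q)) :=
  {A | ∃ s, M.Valid s ∧ Reach M.next State.start s ∧ M.next s = [] ∧ value s.word = v ∧
    M.assembly s = A}

variable (value : List Bool → ℕ)

theorem Machine.mem_terminalWith_iff {t : State} (ht : M.Valid t)
    (hr : Reach M.next State.start t) (v : ℕ) :
    M.assembly t ∈ M.terminalWith value v ↔ M.next t = [] ∧ value t.word = v := by
  constructor
  · rintro ⟨s, hs, hsr, hn, hv, h⟩
    have hn' : M.next t = [] := by
      rw [← M.represents.frontier_eq_empty_iff ht, ← h]
      exact (M.represents.frontier_eq_empty_iff hs).2 hn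
    rw [← ht.word_eq hs (ht.next_eq_nil.1 hn') (hs.next_eq_nil.1 hn) h.symm] at hv
    exact ⟨hn', hv⟩
  · rintro ⟨hn, hv⟩
    exact ⟨t, ht, hr, hn, hv, rfl⟩

theorem Machine.disjoint_terminalWith {v w : ℕ} (hvw : v ≠ w) :
    Disjoint (M.terminalWith value v) (M.terminalWith value w) := by
  rw [Set.disjoint_left]
  rintro _ ⟨s, hs, hsr, hn, hv, rfl⟩ h
  exact hvw (hv.symm.trans ((Machine.mem_terminalWith_iff value hs hsr w).1 h).2)

open Classical in
theorem Machine.probOf_terminalWith (P : Concentration M.system.tileSet) (v : ℕ) :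
    TileSystem.probOf P (M.terminalWith value v) = ∑' k, expect P M.next k
      (fun s => if M.next s = [] then (if value s.word = v then 1 else 0) else 0) State.start := by
  have hR := M.represents.reach State.start
  have h₀ : M.Valid State.start ∧ Reach M.next State.start State.start :=
    ⟨M.valid_start, Relation.ReflTransGen.refl⟩
  rw [hR.probOf_eq P h₀ rfl]
  congr 1
  funext k
  refine expect_congr P hR (fun s hs => ?_) k h₀
  have := Machine.mem_terminalWith_iff value hs.1 hs.2 v
  by_cases h1 : M.next s = [] <;> by_cases h2 : value s.word = v <;> simp_all [Set.indicator]

open Classical in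
theorem Machine.probOf_terminal (P : Concentration M.system.tileSet) :
    TileSystem.probOf P M.system.terminal = ∑' k, expect P M.next k
      (fun s => if M.next s = [] then 1 else 0) State.start := by
  have hR := M.represents.reach State.start
  have h₀ : M.Valid State.start ∧ Reach M.next State.start State.start :=
    ⟨M.valid_start, Relation.ReflTransGen.refl⟩
  rw [hR.probOf_eq P h₀ rfl]
  congr 1
  funext k
  refine expect_congr P hR (fun s hs => ?_) k h₀
  have := Machine.mem_terminal_iff hs.1 hs.2
  by_cases h1 : M.next s = [] <;> simp_all [Set.indicator]

open Classical in
theorem Machine.expectedSpace_eq (P : Concentration M.system.tileSet) :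
    TileSystem.expectedSpace P = ∑' k, expect P M.next k
      (fun s => if M.next s = [] then ((M.assembly s).space : ℝ≥0∞) else 0) State.start := by
  have hR := M.represents.reach State.start
  have h₀ : M.Valid State.start ∧ Reach M.next State.start State.start :=
    ⟨M.valid_start, Relation.ReflTransGen.refl⟩
  rw [hR.expectedSpace_eq P h₀ rfl]
  congr 1
  funext k
  refine expect_congr P hR (fun s hs => ?_) k h₀
  have := Machine.mem_terminal_iff hs.1 hs.2
  by_cases h1 : M.next s = [] <;> simp_all [Set.indicator]

end Outcomes


/-! ### The random number generator. -/

section Main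

variable {n k : ℕ}

/-- The potential of the generator satisfies the inequality for the chain. -/
theorem generator_potential (hk : 0 < k) (hn : n < 2 ^ k)
    (P : Concentration (generator n k hk).system.tileSet) :
    ∃ α β : ℝ≥0∞, α ≠ ⊤ ∧ β ≠ ⊤ ∧ (2 ^ 24)⁻¹ ≤ α * β ∧
      ∀ (κ c F₀ : ℝ≥0∞) (term : ℕ → ℝ≥0∞), κ * 63 ≤ α * β * c → bitVal n c term F₀ k 0 ≤ F₀ →
      ∀ h, (generator n k hk).run h ∈ (generator n k hk).states →
        κ * 63 + raceVal (fun a => Machine.rate P (leftKind a))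
          (fun b => Machine.rate P (rightKind b))
          (drawVal k (bitVal n c term F₀) α β (κ * 63) (draw n k (true :: h)))
          (drawVal k (bitVal n c term F₀) α β (κ * 63) (draw n k (false :: h))) 7 7 ≤
        drawVal k (bitVal n c term F₀) α β (κ * 63) (draw n k h) := by
  obtain ⟨α, β, hαβ, hα, hβ, hrace⟩ := exists_race_probabilities (c := Machine.rate P)
    fun j hj => Machine.rate_ne P (by omega)
  have hle : α ≤ 1 ∧ β ≤ 1 := ⟨hαβ ▸ le_self_add, hαβ ▸ le_add_self⟩
  refine ⟨α, β, ne_top_of_le_ne_top ENNReal.one_ne_top hle.1,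
    ne_top_of_le_ne_top ENNReal.one_ne_top hle.2, ?_, ?_⟩
  · calc ((2 : ℝ≥0∞) ^ 24)⁻¹ = 2⁻¹ ^ 12 * 2⁻¹ ^ 12 := by
          rw [← pow_add, ENNReal.inv_pow]
      _ ≤ α * β := by gcongr
  · intro κ c F₀ term hκ hF h hh
    rw [hrace]
    exact drawVal_step_le hF hαβ hκ _ ((run_generator_mem hk hn h).1 hh)

theorem le_mul_of_inv_le {x a : ℝ≥0∞} {m : ℝ≥0∞} (hm : m ≠ 0) (hm' : m ≠ ⊤) (h : m⁻¹ ≤ x) :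
    a ≤ x * (a * m) := by
  calc a = m⁻¹ * (a * m) := by
        rw [mul_comm a, ← mul_assoc, ENNReal.inv_mul_cancel hm hm', one_mul]
    _ ≤ x * (a * m) := by gcongr

/-- The cost of a random bit. -/
noncomputable def bitCost : ℝ≥0∞ := 1 * 63 * 2 ^ 24

theorem generator_tsum_expect_halted (hk : 0 < k) (hn : n < 2 ^ k) (hkn : 2 ^ k ≤ 2 * n)
    (P : Concentration (generator n k hk).system.tileSet) {s : State}
    (hs : (generator n k hk).Valid s) :
    open Classical in
    ∑' j, expect P (generator n k hk).next j
      (fun s => if (generator n k hk).next s = [] then 1 else 0) s = 1 := by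
  obtain ⟨α, β, hα, hβ, hαβ, h⟩ := generator_potential hk hn P
  have hc : bitCost ≠ ⊤ := by simp [bitCost, ENNReal.mul_eq_top]
  have hF : 2 * (k : ℝ≥0∞) * bitCost ≠ ⊤ :=
    ENNReal.mul_ne_top (ENNReal.mul_ne_top (by simp) (by simp)) hc
  refine hs.tsum_expect_halted (h 1 bitCost (2 * k * bitCost) 0 ?_ (bitVal_const hkn)) fun w => ?_
  · exact le_mul_of_inv_le (by simp) (by simp) hαβ
  · exact drawVal_ne_top (bitVal_ne_top hc (by simp) hF) hα hβ (by simp) _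

theorem generator_expectedSpace_le (hk : 0 < k) (hn : n < 2 ^ k) (hkn : 2 ^ k ≤ 2 * n)
    (P : Concentration (generator n k hk).system.tileSet) :
    TileSystem.expectedSpace P ≤ 2 * k * bitCost + 1 := by
  obtain ⟨α, β, hα, hβ, hαβ, h⟩ := generator_potential hk hn P
  rw [Machine.expectedSpace_eq]
  refine (Machine.tsum_space_le (h 1 bitCost (2 * k * bitCost) 0 ?_ (bitVal_const hkn))).trans ?_
  · exact le_mul_of_inv_le (by simp) (by simp) hαβ
  · rw [Machine.space_start, Nat.cast_one]
    gcongr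
    exact bitVal_const hkn

/-- Under the uniform concentrations the process ends almost surely from every valid state, so an
end is reachable from it. -/
theorem generator_isFinite (hk : 0 < k) (hn : n < 2 ^ k) (hkn : 2 ^ k ≤ 2 * n) :
    (generator n k hk).system.IsFinite := by
  classical
  refine Machine.isFinite fun s hs => ?_
  obtain ⟨P⟩ := (generator n k hk).exists_concentration
  have h1 := generator_tsum_expect_halted hk hn hkn P hs
  obtain ⟨j, hj⟩ : ∃ j, expect P (generator n k hk).next j
      (fun s => if (generator n k hk).next s = [] then 1 else 0) s ≠ 0 := by
    by_contra hcon
    push Not at hcon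
    rw [ENNReal.tsum_eq_zero.2 hcon] at h1
    exact zero_ne_one h1
  obtain ⟨t, ht, hne⟩ := exists_reach_of_expect_ne_zero P hj
  exact ⟨t, ht, by simpa using hne⟩

/-- The terminal assemblies for the number `v`. -/
def generatorPart (n k : ℕ) (hk : 0 < k) (v : ℕ) :
    Set (Assembly (Glue (ℕ × Ordering × Option Bool))) :=
  (generator n k hk).terminalWith (fun w => (draw n k w).2.1) v

theorem generator_value_lt (hk : 0 < k) (hn : n < 2 ^ k) {s : State}
    (hh : (generator n k hk).Halted s) : (draw n k s.word).2.1 < n := by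
  refine draw_lt hk _ ?_
  by_contra hlt
  exact hh.1 ((run_generator_mem hk hn _).2 (not_le.1 hlt))

theorem iUnion_generatorPart (hk : 0 < k) (hn : n < 2 ^ k) :
    ⋃ v : Fin n, generatorPart n k hk v = (generator n k hk).system.terminal := by
  ext A
  rw [Set.mem_iUnion]
  constructor
  · rintro ⟨v, s, hs, hr, hnil, -, rfl⟩
    exact (Machine.mem_terminal_iff hs hr).2 hnil
  · intro hA
    obtain ⟨t, rfl, ht⟩ := (generator n k hk).represents.exists_of_grows
      (generator n k hk).valid_start hA.1
    have hv := ((generator n k hk).represents.of_reach (generator n k hk).valid_start ht).1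
    have hnil := (Machine.mem_terminal_iff hv ht).1 hA
    exact ⟨⟨_, generator_value_lt hk hn (hv.next_eq_nil.1 hnil)⟩, t, hv, ht, hnil, rfl, rfl⟩

theorem generator_probOf_terminal (hk : 0 < k) (hn : n < 2 ^ k) (hkn : 2 ^ k ≤ 2 * n)
    (P : Concentration (generator n k hk).system.tileSet) :
    TileSystem.probOf P (generator n k hk).system.terminal = 1 := by
  rw [Machine.probOf_terminal]
  exact generator_tsum_expect_halted hk hn hkn P (generator n k hk).valid_start

/-- The number of bits grows only when a pair is completed; hence a final counter has nothing
pending and its `drawVal` is the value of a leaf. -/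
theorem drawStep_none {c : Counter} {o : Bool} (hc : c.1 < k) (h : k ≤ (drawStep n k c o).1) :
    (drawStep n k c o).2.2 = none := by
  rcases c with ⟨i, a, _ | b⟩
  · simp only [drawStep] at hc h
    omega
  · simp only [drawStep]
    split_ifs <;> rfl

/-- Attachments are free and the value `v` pays 1. Superharmonicity gives only this upper bound;
equality comes from the total mass 1 by `eq_inv_of_le`. -/
theorem generator_probOf_le (hk : 0 < k) (hn : n < 2 ^ k)
    (P : Concentration (generator n k hk).system.tileSet) (v : Fin n) :
    TileSystem.probOf P (generatorPart n k hk v) ≤ (n : ℝ≥0∞)⁻¹ := by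
  obtain ⟨α, β, hα, hβ, hαβ, h⟩ := generator_potential hk hn P
  have hbit := bitVal_indicator (v.pos) hn.le v.isLt
  rw [generatorPart, Machine.probOf_terminalWith]
  refine (Machine.tsum_payoff_le (h 0 0 (n : ℝ≥0∞)⁻¹ (fun u => if u = v then 1 else 0) (by simp)
    hbit.le) (fun s => if (draw n k s.word).2.1 = v then 1 else 0) fun s hs hh => ?_).trans hbit.le
  split_ifs with hv
  · have hi : k ≤ (draw n k s.word).1 := by
      by_contra hlt
      exact hh.1 ((run_generator_mem hk hn _).2 (not_le.1 hlt))
    have hlt := generator_value_lt hk hn hh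
    have hrun : (draw n k s.1).1 < k :=
      (run_generator_mem hk hn _).1 (hs.running _ (List.suffix_refl _))
    have hnone := drawStep_none hrun hi
    have hdraw : draw n k s.word = ((draw n k s.word).1, (v : ℕ), none) :=
      Prod.ext rfl (Prod.ext hv hnone)
    rw [hdraw, drawVal, Nat.sub_eq_zero_of_le hi, bitVal, if_pos v.isLt, if_pos rfl]
  · exact zero_le

theorem eq_inv_of_le {x : Fin n → ℝ≥0∞} (hn : 0 < n) (hle : ∀ i, x i ≤ (n : ℝ≥0∞)⁻¹)
    (hsum : ∑ i, x i = 1) (i : Fin n) : x i = (n : ℝ≥0∞)⁻¹ := by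
  have hn0 : (n : ℝ≥0∞) ≠ 0 := by exact_mod_cast hn.ne'
  refine le_antisymm (hle i) ?_
  by_contra hlt
  have hfin : ∀ j ∈ Finset.univ, x j ≠ ⊤ := fun j _ => ne_top_of_le_ne_top (by simp [hn.ne']) (hle j)
  have : ∑ j, x j < ∑ _j : Fin n, (n : ℝ≥0∞)⁻¹ := by
    rw [← Finset.add_sum_erase _ _ (Finset.mem_univ i),
      ← Finset.add_sum_erase _ (fun _ => (n : ℝ≥0∞)⁻¹) (Finset.mem_univ i)]
    refine ENNReal.add_lt_add_of_lt_of_le ?_ (not_le.1 hlt) (Finset.sum_le_sum fun j _ => hle j)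
    exact ENNReal.sum_ne_top.2 fun j _ => hfin j (Finset.mem_univ j)
  rw [hsum, Finset.sum_const, Finset.card_univ, Fintype.card_fin, nsmul_eq_mul,
    ENNReal.mul_inv_cancel hn0 (by simp)] at this
  exact lt_irrefl _ this

theorem probOf_iUnion {G : Type} {Γ : TileSystem G} (P : Concentration Γ.tileSet)
    {X : Fin n → Set (Assembly G)} (hX : Pairwise (Function.onFun Disjoint X)) :
    TileSystem.probOf P (⋃ i, X i) = ∑ i, TileSystem.probOf P (X i) := by
  unfold TileSystem.probOf
  rw [ENNReal.tsum_biUnion (f := TileSystem.probTerm P) fun i _ j _ hij => hX hij, tsum_fintype]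

end Main

end ATAM

/-- The additive `1` only matters for `n = 1`, where `log n = 0` but every tile set is non-empty. -/
theorem mainTheorem7 :
    ∃ C : ℝ, ∀ n : ℕ, 1 ≤ n → ∃ (G : Type) (Γ : ATAM.TileSystem G),
      Γ.temperature = 2 ∧
      Γ.seed.space = 1 ∧
      Γ.Extensible 2 ∧
      (Γ.tileSet.card : ℝ) ≤ C * (Real.log n + 1) ∧
      Γ.IsFairRobustRandomGenerator n ∧
      ∀ P : ATAM.Concentration Γ.tileSet,
        ATAM.TileSystem.probOf P Γ.terminal = 1 ∧
        ATAM.TileSystem.expectedSpace P ≤ ENNReal.ofReal (C * (Real.log n + 1)) := by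
  open ATAM in
  -- The space bound decides: 2k · 63 · 2^24 + 1 with k ≤ 2 (log n + 1) stays below 2^33 (log n +
  -- 1).
  refine ⟨2 ^ 33, fun n hn => ?_⟩
  obtain ⟨k, hk⟩ : ∃ k, k = Nat.log 2 n + 1 := ⟨_, rfl⟩
  have hk0 : 0 < k := by omega
  have hn2 : n < 2 ^ k := hk ▸ Nat.lt_pow_succ_log_self one_lt_two n
  have hkn : 2 ^ k ≤ 2 * n := by
    rw [hk, pow_succ, mul_comm]
    exact Nat.mul_le_mul_left 2 (Nat.pow_log_le_self 2 (by omega))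
  have hkR : (k : ℝ) ≤ 2 * (Real.log n + 1) := by
    have h1 : Real.log 2 * (Nat.log 2 n : ℝ) ≤ Real.log n := by
      rw [mul_comm, ← Real.log_pow]
      exact Real.log_le_log (by positivity) (by exact_mod_cast Nat.pow_log_le_self 2 (by omega))
    have h2 := Real.log_two_gt_d9
    have h3 : (0 : ℝ) ≤ (Nat.log 2 n : ℝ) := Nat.cast_nonneg _
    rw [hk]
    push_cast
    nlinarith
  have hk1 : (1 : ℝ) ≤ k := by exact_mod_cast hk0
  set M := generator n k hk0 with hM
  have hdisj : Pairwise (Function.onFun Disjoint fun v : Fin n => generatorPart n k hk0 v) :=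
    fun i j hij => Machine.disjoint_terminalWith _ fun h => hij (Fin.ext h)
  have hprob : ∀ (P : Concentration M.system.tileSet) (v : Fin n),
      TileSystem.probOf P (generatorPart n k hk0 v) = (n : ℝ≥0∞)⁻¹ := fun P v => by
    refine eq_inv_of_le hn (x := fun v : Fin n => TileSystem.probOf P (generatorPart n k hk0 v))
      (generator_probOf_le hk0 hn2 P) ?_ v
    rw [← probOf_iUnion P hdisj, iUnion_generatorPart hk0 hn2]
    exact generator_probOf_terminal hk0 hn2 hkn P
  refine ⟨_, M.system, rfl, M.space_start, M.extensible, ?_, ⟨generator_isFinite hk0 hn2 hkn,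
    fun v : Fin n => generatorPart n k hk0 v, fun v => ?_, hdisj, iUnion_generatorPart hk0 hn2,
    fun P i j => ?_⟩, fun P => ⟨generator_probOf_terminal hk0 hn2 hkn P, ?_⟩⟩
  · have h1 : M.system.tileSet.card ≤ 12 + 47 * (9 * k) := by
      rw [← card_generatorStates k]
      exact M.card_tileSet_le
    have h2 : (M.system.tileSet.card : ℝ) ≤ 12 + 47 * (9 * k) := by exact_mod_cast h1
    refine h2.trans ?_
    linarith
  -- A part is non-empty because its probability 1/n is positive.
  · obtain ⟨P⟩ := M.exists_concentration
    by_contra hemp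
    rw [Set.not_nonempty_iff_eq_empty] at hemp
    have h := hprob P v
    rw [show generatorPart n k hk0 v = ∅ from hemp] at h
    rw [TileSystem.probOf, tsum_empty] at h
    exact ENNReal.inv_ne_zero.2 (ENNReal.natCast_ne_top n) h.symm
  · rw [hprob P i, hprob P j]
    exact le_self_add
  · refine (generator_expectedSpace_le hk0 hn2 hkn P).trans ?_
    have h1 : 2 * (k : ℝ≥0∞) * bitCost + 1 = ENNReal.ofReal (2 * k * (1 * 63 * 2 ^ 24) + 1) := by
      rw [bitCost, ENNReal.ofReal_add (by positivity) (by positivity), ENNReal.ofReal_mul (by positivity),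
        ENNReal.ofReal_mul (by positivity), ENNReal.ofReal_natCast]
      norm_num
    rw [h1]
    apply ENNReal.ofReal_le_ofReal
    linarith
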